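/- Let $(M^6,g,J)$ be an almost hermitian manifold: a smooth 6-manifold with a Riemannian metric $g$ and a smooth $g$-orthogonal almost complex structure $J$, with Kähler form $\Omega(X,Y)=g(JX,Y)$. Assume that it admits a characteristic connection, i.e. a connection $\nabla^c$ with $\nabla^c g=0$, $\nabla^c J=0$ whose torsion $T^c(X,Y,Z)=g(\nabla^c_XY-\nabla^c_YX-[X,Y],Z)$ is totally skew-symmetric, and that the torsion is parallel, $\nabla^cT^c=0$. Identify tangent spaces with $\mathbb R^6$ by adapted frames $(e_1,\dots,e_6)$ (orthonormal with $\Omega=e_{12}+e_{34}+e_{56}$). Put $\tau(T)=\sum_i(e_i\lrcorner\Omega)\wedge(e_i\lrcorner T)$ on $\Lambda^3(\mathbb R^6)$ and decompose orthogonally $\Lambda^3(\mathbb R^6)=\Lambda^3_2\oplus\Lambda^3_{12}\oplus\Lambda^3_6$ (the subscripts are the real dimensions), where $\Lambda^3_2=\{T:\tau^2T=-9T\}$, $\Lambda^3_6=\{\Omega\wedge X: X\in\mathbb R^6\}$ and $\Lambda^3_{12}$ is the orthogonal complement of $\Lambda^3_2\oplus\Lambda^3_6$. Let $\mathfrak m^6\subset\mathfrak{so}(6)=\Lambda^2(\mathbb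 R^6)$ be the space of skew-symmetric endomorphisms anti-commuting with $J$, and let $\theta(T)=-\frac12\sum_i e_i\otimes \mathrm{pr}_{\mathfrak m^6}(e_i\lrcorner T)$, an injective map $\Lambda^3(\mathbb R^6)\to\mathbb R^6\otimes\mathfrak m^6$. Let $\Gamma$ be the intrinsic torsion, i.e. the $\mathbb R^6\otimes\mathfrak m^6$-part of the Levi-Civita connection form $\omega_{ij}=g(\nabla^g e_i,e_j)$ in adapted frames, and for $i\in\{2,12,6\}$ let $T_i\in\Lambda^3_i$ be the 3-form such that $\theta(T_i)$ is the orthogonal projection of $\Gamma$ onto $\theta(\Lambda^3_i)$. Norms of 3-forms are those for which the $e_{ijk}$, $i<j<k$, are orthonormal, and $T^c$ is regarded as an element of the Clifford algebra $Cl(\mathbb R^6)$ (with $e_ie_j+e_je_i=-2\delta_{ij}$) through $e_{ijk}\mapsto e_ie_je_k$ for $i<j<k$. Then the following are equivalent (each condition being required at every point of $M$): (i) $(T^c)^2\in\mathbb R\subset Cl(\mathbb R^6)$; (ii) $3\|T_2\|^2-\|T_{12}\|^2+\|T_6\|^2=0$; (iii) $dT^c=0$. -/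

import Mathlib

open Bundle VectorField
open scoped Manifold ContDiff

noncomputable section

namespace AlmostHermitian

/-! ### Linear algebra of the standard hermitian space `ℝ⁶`

Covariant 3-tensors are given by their components in an adapted orthonormal basis. -/

/-- The space of 3-tensors on `ℝ⁶`, with the inner product in which the `e_i ⊗ e_j ⊗ e_k` are
orthonormal. -/
abbrev Ten3 : Type := EuclideanSpace ℝ (Fin 6 × Fin 6 × Fin 6)

/-- The tensor with components `f i j k`. -/
def ten (f : Fin 6 → Fin 6 → Fin 6 → ℝ) : Ten3 := WithLp.toLp 2 fun t => f t.1 t.2.1 t.2.2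

@[simp] theorem ten_apply (f : Fin 6 → Fin 6 → Fin 6 → ℝ) (i j k : Fin 6) :
    ten f (i, j, k) = f i j k := rfl

/-- Components `Ω(e_i, e_j) = g(J e_i, e_j)` of the Kähler form `e₁₂ + e₃₄ + e₅₆`. -/
def Om : Matrix (Fin 6) (Fin 6) ℝ :=
  !![ 0, 1, 0, 0, 0, 0;
     -1, 0, 0, 0, 0, 0;
      0, 0, 0, 1, 0, 0;
      0, 0, -1, 0, 0, 0;
      0, 0, 0, 0, 0, 1;
      0, 0, 0, 0, -1, 0]

/-- `Λ³(ℝ⁶)`: the totally skew-symmetric 3-tensors. -/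
def Lam3 : Submodule ℝ Ten3 where
  carrier := {T | ∀ i j k, T (i, j, k) = -T (j, i, k) ∧ T (i, j, k) = -T (i, k, j)}
  zero_mem' := by intro i j k; simp
  add_mem' := by
    intro S T hS hT i j k
    refine ⟨?_, ?_⟩
    · simp only [PiLp.add_apply, (hS i j k).1, (hT i j k).1]; ring
    · simp only [PiLp.add_apply, (hS i j k).2, (hT i j k).2]; ring
  smul_mem' := by
    intro c T hT i j k
    refine ⟨?_, ?_⟩
    · simp only [PiLp.smul_apply, smul_eq_mul, (hT i j k).1]; ring
    · simp only [PiLp.smul_apply, smul_eq_mul, (hT i j k).2]; ring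

/-- `τ(T) = ∑ₗ (eₗ ⌟ Ω) ∧ (eₗ ⌟ T)`. -/
def tau : Ten3 →ₗ[ℝ] Ten3 where
  toFun T := ten fun i j k =>
    ∑ l, (Om l i * T (l, j, k) - Om l j * T (l, i, k) + Om l k * T (l, i, j))
  map_add' S T := by
    ext ⟨i, j, k⟩
    simp only [ten_apply, PiLp.add_apply, ← Finset.sum_add_distrib]
    exact Finset.sum_congr rfl fun l _ => by ring
  map_smul' c T := by
    ext ⟨i, j, k⟩
    simp only [ten_apply, PiLp.smul_apply, smul_eq_mul, RingHom.id_apply, Finset.mul_sum]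
    exact Finset.sum_congr rfl fun l _ => by ring

/-- `X ↦ Ω ∧ X`. -/
def omWedge : (Fin 6 → ℝ) →ₗ[ℝ] Ten3 where
  toFun X := ten fun i j k => Om i j * X k - Om i k * X j + Om j k * X i
  map_add' X Y := by
    ext ⟨i, j, k⟩
    simp only [ten_apply, PiLp.add_apply, Pi.add_apply]; ring
  map_smul' c X := by
    ext ⟨i, j, k⟩
    simp only [ten_apply, PiLp.smul_apply, Pi.smul_apply, smul_eq_mul, RingHom.id_apply]; ring

/-- `Λ³₂`, the real part of `Λ^{3,0} ⊕ Λ^{0,3}`: the eigenspace of `τ²` for `-9`. -/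
def Lam2 : Submodule ℝ Ten3 := Lam3 ⊓ LinearMap.ker (tau ∘ₗ tau + (9 : ℝ) • LinearMap.id)

/-- `Λ³₆ = {Ω ∧ X}`. -/
def Lam6 : Submodule ℝ Ten3 := LinearMap.range omWedge

/-- `Λ³₁₂`, the orthogonal complement of `Λ³₂ ⊕ Λ³₆` in `Λ³`: the primitive forms in the real part
of `Λ^{2,1} ⊕ Λ^{1,2}`. -/
def Lam12 : Submodule ℝ Ten3 := Lam3 ⊓ (Lam2 ⊔ Lam6)ᗮ

/-- For a tensor `A` in `ℝ⁶ ⊗ Λ²(ℝ⁶)` (first index in `ℝ⁶`), the projection onto `ℝ⁶ ⊗ 𝔪⁶`, with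
`𝔪⁶ ⊆ Λ²(ℝ⁶) = 𝔰𝔬(6)` the forms `β` such that `β(J·, J·) = -β`. -/
def prM : Ten3 →ₗ[ℝ] Ten3 where
  toFun A := ten fun k i j =>
    1 / 2 * (A (k, i, j) - ∑ a, ∑ b, Om i a * Om j b * A (k, a, b))
  map_add' S T := by
    ext ⟨k, i, j⟩
    simp only [ten_apply, PiLp.add_apply, mul_add, Finset.sum_add_distrib]; ring
  map_smul' c T := by
    ext ⟨k, i, j⟩
    simp only [ten_apply, PiLp.smul_apply, smul_eq_mul, RingHom.id_apply, mul_sub, Finset.mul_sum]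
    congr 1
    · ring
    · exact Finset.sum_congr rfl fun a _ => Finset.sum_congr rfl fun b _ => by ring

/-- `θ(T) = -1/2 ∑ₖ eₖ ⊗ pr_𝔪(eₖ ⌟ T)`. -/
def theta : Ten3 →ₗ[ℝ] Ten3 := (-(1 / 2) : ℝ) • prM

/-- For a submodule `L` of `Λ³` and `Γ ∈ ℝ⁶ ⊗ 𝔪⁶`: the form `T ∈ L` such that `θ(T)` is the
orthogonal projection of `Γ` onto `θ(L)`. It is unique since `θ` is injective on `Λ³`. -/
def formComponent (L : Submodule ℝ Ten3) (Γ : Ten3) : Ten3 :=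
  Function.invFunOn theta (L : Set Ten3) ((L.map theta).starProjection Γ)

/-- `‖T‖²` for a 3-form `T`, where the `e_i ∧ e_j ∧ e_k`, `i < j < k`, are orthonormal. -/
def formNormSq (T : Ten3) : ℝ :=
  ∑ i : Fin 6, ∑ j ∈ Finset.Ioi i, ∑ k ∈ Finset.Ioi j, T (i, j, k) ^ 2

/-- The Clifford algebra `Cl(ℝ⁶)`, with `e_i e_j + e_j e_i = -2 δ_ij`. -/
abbrev Cl6 : Type :=
  CliffordAlgebra (QuadraticMap.weightedSumSquares ℝ (fun _ : Fin 6 => (-1 : ℝ)))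

/-- The basis vector `e_i` in `Cl(ℝ⁶)`. -/
def clE (i : Fin 6) : Cl6 :=
  CliffordAlgebra.ι (QuadraticMap.weightedSumSquares ℝ (fun _ : Fin 6 => (-1 : ℝ)))
    (Pi.single i 1)

/-- A 3-form as an element of `Cl(ℝ⁶)`: `e_i ∧ e_j ∧ e_k ↦ e_i e_j e_k` for `i < j < k`. -/
def toCl (T : Ten3) : Cl6 :=
  ∑ i : Fin 6, ∑ j ∈ Finset.Ioi i, ∑ k ∈ Finset.Ioi j, T (i, j, k) • (clE i * clE j * clE k)

/-! ### Almost hermitian geometry in dimension six -/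

/-- Model space. -/
abbrev R6 : Type := EuclideanSpace ℝ (Fin 6)

section Manifold

variable {M : Type*} [TopologicalSpace M] [ChartedSpace R6 M] [IsManifold (𝓡 6) ∞ M]

/-- The exterior derivative of a 3-form `α`, evaluated on vector fields. -/
def extDerivThree (α : (p : M) → TangentSpace (𝓡 6) p → TangentSpace (𝓡 6) p → TangentSpace (𝓡 6) p → ℝ)
    (X Y Z W : (p : M) → TangentSpace (𝓡 6) p) (p : M) : ℝ :=
  mvfderiv (𝓡 6) (fun q => α q (Y q) (Z q) (W q)) p (X p)
  - mvfderiv (𝓡 6) (fun q => α q (X q) (Z q) (W q)) p (Y p)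
  + mvfderiv (𝓡 6) (fun q => α q (X q) (Y q) (W q)) p (Z p)
  - mvfderiv (𝓡 6) (fun q => α q (X q) (Y q) (Z q)) p (W p)
  - α p (mlieBracket (𝓡 6) X Y p) (Z p) (W p)
  + α p (mlieBracket (𝓡 6) X Z p) (Y p) (W p)
  - α p (mlieBracket (𝓡 6) X W p) (Y p) (Z p)
  - α p (mlieBracket (𝓡 6) Y Z p) (X p) (W p)
  + α p (mlieBracket (𝓡 6) Y W p) (X p) (Z p)
  - α p (mlieBracket (𝓡 6) Z W p) (X p) (Y p)

/-- `dα = 0` for a 3-form `α`: it vanishes on all (locally defined) smooth vector fields. -/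
def IsClosedThree (α : (p : M) → TangentSpace (𝓡 6) p → TangentSpace (𝓡 6) p → TangentSpace (𝓡 6) p → ℝ) : Prop :=
  ∀ (p : M) (X Y Z W : (p : M) → TangentSpace (𝓡 6) p),
    ContMDiffAt (𝓡 6) (𝓡 6).tangent ∞ (fun q => (⟨q, X q⟩ : TangentBundle (𝓡 6) M)) p →
    ContMDiffAt (𝓡 6) (𝓡 6).tangent ∞ (fun q => (⟨q, Y q⟩ : TangentBundle (𝓡 6) M)) p →
    ContMDiffAt (𝓡 6) (𝓡 6).tangent ∞ (fun q => (⟨q, Z q⟩ : TangentBundle (𝓡 6) M)) p →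
    ContMDiffAt (𝓡 6) (𝓡 6).tangent ∞ (fun q => (⟨q, W q⟩ : TangentBundle (𝓡 6) M)) p →
    extDerivThree α X Y Z W p = 0

variable [RiemannianBundle (TangentSpace (𝓡 6) : M → Type)]

/-- `J` is a smooth orthogonal almost complex structure. -/
structure IsOrthogonalAlmostComplex (J : (p : M) → TangentSpace (𝓡 6) p →L[ℝ] TangentSpace (𝓡 6) p) : Prop where
  smooth : ContMDiff (𝓡 6) ((𝓡 6).prod 𝓘(ℝ, R6 →L[ℝ] R6)) ∞
    (fun p => TotalSpace.mk' (R6 →L[ℝ] R6) (E := fun p : M => TangentSpace (𝓡 6) p →L[ℝ] TangentSpace (𝓡 6) p) p (J p))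
  sq : ∀ (p : M) (x : TangentSpace (𝓡 6) p), J p (J p x) = -x
  orthogonal : ∀ (p : M) (x y : TangentSpace (𝓡 6) p), inner ℝ (J p x) (J p y) = inner ℝ x y

/-- An adapted frame at `p`: an orthonormal basis of the tangent space with
`Ω = e₁₂ + e₃₄ + e₅₆`, where `Ω(x, y) = g(J x, y)`. -/
structure IsAdaptedFrame (J : (p : M) → TangentSpace (𝓡 6) p →L[ℝ] TangentSpace (𝓡 6) p) (p : M) (e : Fin 6 → TangentSpace (𝓡 6) p) :
    Prop where
  orthonormal : Orthonormal ℝ e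
  kahler : ∀ i j, inner ℝ (J p (e i)) (e j) = Om i j

/-- `g(∇^g_X Y, Z)` for the Levi-Civita connection `∇^g`, by the Koszul formula. -/
def leviCivita (X Y Z : (p : M) → TangentSpace (𝓡 6) p) (p : M) : ℝ :=
  1 / 2 *
    (mvfderiv (𝓡 6) (fun q => inner ℝ (Y q) (Z q)) p (X p)
    + mvfderiv (𝓡 6) (fun q => inner ℝ (X q) (Z q)) p (Y p)
    - mvfderiv (𝓡 6) (fun q => inner ℝ (X q) (Y q)) p (Z p)
    + inner ℝ (mlieBracket (𝓡 6) X Y p) (Z p)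
    - inner ℝ (mlieBracket (𝓡 6) X Z p) (Y p)
    - inner ℝ (mlieBracket (𝓡 6) Y Z p) (X p))

/-- The intrinsic torsion at `p` as a tensor:
`Γ(x)(y, z) = 1/2 (g(∇^g_x Y, z) - g(∇^g_x (J Y), J z))` for any vector field `Y` extending `y`. In
an adapted local frame `e` this is the `ℝ⁶ ⊗ 𝔪⁶`-part of the connection form
`ω_ij = g(∇^g e_i, e_j)`, because the `J e_i` have constant coefficients there. -/
def intrinsicTorsion (J : (p : M) → TangentSpace (𝓡 6) p →L[ℝ] TangentSpace (𝓡 6) p) (p : M) (x y z : TangentSpace (𝓡 6) p) : ℝ :=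
  1 / 2 *
    (leviCivita (FiberBundle.extend R6 x) (FiberBundle.extend R6 y) (FiberBundle.extend R6 z) p
    - leviCivita (FiberBundle.extend R6 x) (fun q => J q (FiberBundle.extend R6 y q))
        (fun q => J q (FiberBundle.extend R6 z q)) p)

/-- Components in a frame of a covariant 3-tensor at a point. -/
def components {p : M} (α : TangentSpace (𝓡 6) p → TangentSpace (𝓡 6) p → TangentSpace (𝓡 6) p → ℝ) (e : Fin 6 → TangentSpace (𝓡 6) p) : Ten3 :=
  ten fun i j k => α (e i) (e j) (e k)

/-- The 3-form `T₂` (in the frame `e`): `T₂ ∈ Λ³₂` and `θ(T₂) = Γ₂`, the projection of the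
intrinsic torsion onto `θ(Λ³₂)`. -/
def T2 (J : (p : M) → TangentSpace (𝓡 6) p →L[ℝ] TangentSpace (𝓡 6) p) (p : M) (e : Fin 6 → TangentSpace (𝓡 6) p) : Ten3 :=
  formComponent Lam2 (components (intrinsicTorsion J p) e)

/-- The 3-form `T₁₂` (in the frame `e`): `T₁₂ ∈ Λ³₁₂` and `θ(T₁₂) = Γ₁₂`. -/
def T12 (J : (p : M) → TangentSpace (𝓡 6) p →L[ℝ] TangentSpace (𝓡 6) p) (p : M) (e : Fin 6 → TangentSpace (𝓡 6) p) : Ten3 :=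
  formComponent Lam12 (components (intrinsicTorsion J p) e)

/-- The 3-form `T₆` (in the frame `e`): `T₆ ∈ Λ³₆` and `θ(T₆) = Γ₆`. -/
def T6 (J : (p : M) → TangentSpace (𝓡 6) p →L[ℝ] TangentSpace (𝓡 6) p) (p : M) (e : Fin 6 → TangentSpace (𝓡 6) p) : Ten3 :=
  formComponent Lam6 (components (intrinsicTorsion J p) e)

/-- The torsion of a connection as a `(3,0)`-tensor, `T(x, y, z) = g(T(x, y), z)`. -/
def torsionForm (cov : CovariantDerivative (𝓡 6) R6 (TangentSpace (𝓡 6) : M → Type)) (p : M) (x y z : TangentSpace (𝓡 6) p) : ℝ :=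
  inner ℝ (cov.torsion p x y) z

variable [IsContMDiffRiemannianBundle (𝓡 6) ∞ R6 (TangentSpace (𝓡 6) : M → Type)]

set_option synthInstance.maxHeartbeats 400000 in
/-- `cov` is the characteristic connection of `(g, J)`: a smooth connection such that `g` and `J`
are parallel and the torsion is totally skew-symmetric. -/
structure IsCharacteristicConnection (J : (p : M) → TangentSpace (𝓡 6) p →L[ℝ] TangentSpace (𝓡 6) p)
    (cov : CovariantDerivative (𝓡 6) R6 (TangentSpace (𝓡 6) : M → Type)) : Prop where
  smooth : cov.ContMDiffCovariantDerivative ∞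
  metric : cov.IsMetricCompatible
  complex : ∀ (p : M) (x : TangentSpace (𝓡 6) p) (Y : (p : M) → TangentSpace (𝓡 6) p),
    MDifferentiableAt (𝓡 6) (𝓡 6).tangent (fun q => (⟨q, Y q⟩ : TangentBundle (𝓡 6) M)) p →
    cov (fun q => J q (Y q)) p x = J p (cov Y p x)
  skew : ∀ (p : M) (x y z : TangentSpace (𝓡 6) p), torsionForm cov p x y z = -torsionForm cov p x z y

/-- The torsion form of `cov` is parallel with respect to `cov`. -/
def HasParallelTorsion (cov : CovariantDerivative (𝓡 6) R6 (TangentSpace (𝓡 6) : M → Type)) : Prop :=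
  ∀ (p : M) (w : TangentSpace (𝓡 6) p) (X Y Z : (p : M) → TangentSpace (𝓡 6) p),
    MDifferentiableAt (𝓡 6) (𝓡 6).tangent (fun q => (⟨q, X q⟩ : TangentBundle (𝓡 6) M)) p →
    MDifferentiableAt (𝓡 6) (𝓡 6).tangent (fun q => (⟨q, Y q⟩ : TangentBundle (𝓡 6) M)) p →
    MDifferentiableAt (𝓡 6) (𝓡 6).tangent (fun q => (⟨q, Z q⟩ : TangentBundle (𝓡 6) M)) p →
    mvfderiv (𝓡 6) (fun q => torsionForm cov q (X q) (Y q) (Z q)) p w =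
      torsionForm cov p (cov X p w) (Y p) (Z p) + torsionForm cov p (X p) (cov Y p w) (Z p)
      + torsionForm cov p (X p) (Y p) (cov Z p w)

end Manifold

end AlmostHermitian

end

/-! Everything is governed by the 4-form σ, the cyclic sum over x, y, z of g(T(x,y), T(z,w)). Since
the torsion is parallel, dT = 2σ (`IsCharacteristicConnection.extDerivThree_eq`), so (iii) means σ =
0. In the Clifford algebra T² has only parts of degree 0 and 4, and the latter is a multiple of σ,
so (i) also means σ = 0 (`toCl_sq_iff`). The intrinsic torsion is θ(T), hence the T_i are the
components of T, and the expression in (ii) is the pairing of σ with Ω ∧ Ω, that is, twice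
`sigTrace` (`formComponent_combination`). So (iii) implies (ii).

The converse, that this single trace controls all of σ, is the main point
(`sigmaTensor_eq_zero_of_sigTrace`). It rests on curvature: the curvature operators of ∇^c are
skew-hermitian and annihilate T, and the Bianchi identity expresses σ as the cyclic sum of R(x,y)z.
Let 𝔥 be the skew-hermitian endomorphisms annihilating T. If 𝔥 kills some v ≠ 0, it kills Jv, so σ
lives on a 4-dimensional complement and its only component is the trace
(`sigmaTensor_eq_zero_of_kernel`). Otherwise the trace of T with Ω, which 𝔥 kills, is zero, so T₆ =
0, and some A ≠ 0 lies in 𝔥. Diagonalise A. The trace is now a difference of squares, the (3,0)-part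
against the primitive (2,1)-part, and comparing weights gives T = 0 unless A = diag(iα, -iα, 0) up
to order. In that case T has an explicit normal form (`IsReduced`): either one quadratic relation
holds and σ = 0, or all of 𝔥 kills the third complex line, which was excluded. -/

noncomputable section

namespace AlmostHermitian

/-! ### Smooth vector fields and their brackets. -/

section Manifold
variable {M : Type*} [TopologicalSpace M] [ChartedSpace R6 M] [IsManifold (𝓡 6) ∞ M]

/-- A globally smooth vector field. -/
abbrev IsSmoothField (X : (p : M) → TangentSpace (𝓡 6) p) : Prop :=
  ContMDiff (𝓡 6) (𝓡 6).tangent ∞ (fun q => (⟨q, X q⟩ : TangentBundle (𝓡 6) M))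

/-- A vector field differentiable at `p`. -/
abbrev IsDiffFieldAt (X : (p : M) → TangentSpace (𝓡 6) p) (p : M) : Prop :=
  MDifferentiableAt (𝓡 6) (𝓡 6).tangent (fun q => (⟨q, X q⟩ : TangentBundle (𝓡 6) M)) p

theorem IsSmoothField.diffAt {X : (p : M) → TangentSpace (𝓡 6) p} (hX : IsSmoothField X) (p : M) :
    IsDiffFieldAt X p := (hX p).mdifferentiableAt (by simp)

/-- A local extension cut off by a bump function. With global fields, iterated derivatives and
brackets stay smooth everywhere. -/
theorem exists_isSmoothField [T2Space M] (p : M) (v : TangentSpace (𝓡 6) p) :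
    ∃ X : (p : M) → TangentSpace (𝓡 6) p, IsSmoothField X ∧ X p = v := by
  obtain ⟨s, hs, hX⟩ := FiberBundle.exists_contMDiffOn_extend (k := ∞) (𝓡 6) R6 v
  obtain ⟨u, hus, hu, hpu⟩ := mem_nhds_iff.1 hs
  obtain ⟨f, -, hf⟩ := (SmoothBumpFunction.nhds_basis_tsupport (I := 𝓡 6) p).mem_iff.1
    (hu.mem_nhds hpu)
  refine ⟨fun q => f q • FiberBundle.extend R6 v q, ?_, ?_⟩
  · exact ContMDiffOn.smul_section_of_tsupport f.contMDiff.contMDiffOn hu hf (hX.mono hus)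
  · simp

variable {X Y Z W : (p : M) → TangentSpace (𝓡 6) p}

theorem IsSmoothField.lieBracket (hX : IsSmoothField X) (hY : IsSmoothField Y) :
    IsSmoothField (mlieBracket (𝓡 6) X Y) := by
  intro p
  have : IsManifold (𝓡 6) ((⊤ : ℕ∞) + 1) M := by
    simpa using (inferInstance : IsManifold (𝓡 6) ∞ M)
  have : IsManifold (𝓡 6) (minSmoothness ℝ 2) M := by
    rw [minSmoothness_of_isRCLikeNormedField]; infer_instance
  exact ContMDiffAt.mlieBracket_vectorField (m := ⊤) (n := ⊤) (hX p) (hY p) (by simp)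

theorem jacobi_mlieBracket (hX : IsSmoothField X) (hY : IsSmoothField Y) (hZ : IsSmoothField Z)
    (p : M) : mlieBracket (𝓡 6) X (mlieBracket (𝓡 6) Y Z) p =
      mlieBracket (𝓡 6) (mlieBracket (𝓡 6) X Y) Z p +
      mlieBracket (𝓡 6) Y (mlieBracket (𝓡 6) X Z) p := by
  have : IsManifold (𝓡 6) (minSmoothness ℝ 3) M := by
    rw [minSmoothness_of_isRCLikeNormedField]; infer_instance
  apply leibniz_identity_mlieBracket_apply
  all_goals rw [minSmoothness_of_isRCLikeNormedField]
  · exact (hX p).of_le ENat.LEInfty.out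
  · exact (hY p).of_le ENat.LEInfty.out
  · exact (hZ p).of_le ENat.LEInfty.out

/-- The Lie bracket acts on functions as the commutator of derivations. -/
theorem mvfderiv_mlieBracket [T2Space M] (hX : IsSmoothField X) (hY : IsSmoothField Y) {f : M → ℝ}
    (hf : ContMDiff (𝓡 6) 𝓘(ℝ) ∞ f)
    (hXf : ContMDiff (𝓡 6) 𝓘(ℝ) ∞ fun q => mvfderiv (𝓡 6) f q (X q))
    (hYf : ContMDiff (𝓡 6) 𝓘(ℝ) ∞ fun q => mvfderiv (𝓡 6) f q (Y q)) (p : M) :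
    mvfderiv (𝓡 6) f p (mlieBracket (𝓡 6) X Y p) =
      mvfderiv (𝓡 6) (fun q => mvfderiv (𝓡 6) f q (Y q)) p (X p) -
      mvfderiv (𝓡 6) (fun q => mvfderiv (𝓡 6) f q (X q)) p (Y p) := by
  -- The Jacobi identity for `X`, `Y`, `f • Z`, expanded by the Leibniz rule, minus `f` times the
  -- one for `X`, `Y`, `Z`, leaves a multiple of `Z p`. Choosing `Z p ≠ 0` makes the coefficient
  -- vanish, which is the claim.
  obtain ⟨v, hv⟩ : ∃ v : TangentSpace (𝓡 6) p, v ≠ 0 := exists_ne (α := R6) 0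
  obtain ⟨Z, hZ, rfl⟩ := exists_isSmoothField p v
  have hd : ∀ {g : M → ℝ}, ContMDiff (𝓡 6) 𝓘(ℝ) ∞ g → ∀ q, MDifferentiableAt (𝓡 6) 𝓘(ℝ) g q :=
    fun h q => (h q).mdifferentiableAt (by simp)
  have key : ∀ {V : (p : M) → TangentSpace (𝓡 6) p} {g : M → ℝ}, ContMDiff (𝓡 6) 𝓘(ℝ) ∞ g →
      mlieBracket (𝓡 6) V (g • Z) =
        (fun q => mvfderiv (𝓡 6) g q (V q)) • Z + g • mlieBracket (𝓡 6) V Z := by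
    intro V g hg
    ext1 q
    simpa using mlieBracket_smul_right (V := V) (hd hg q) (hZ.diffAt q)
  have key2 : ∀ {V U : (p : M) → TangentSpace (𝓡 6) p} {g : M → ℝ}, ContMDiff (𝓡 6) 𝓘(ℝ) ∞ g →
      IsSmoothField U →
      mlieBracket (𝓡 6) V (g • U) p =
        mvfderiv (𝓡 6) g p (V p) • U p + g p • mlieBracket (𝓡 6) V U p := by
    intro V U g hg hU
    exact mlieBracket_smul_right (V := V) (hd hg p) (hU.diffAt p)
  have hfZ : IsSmoothField (f • Z) := hf.smul_section hZ
  have J1 := jacobi_mlieBracket hX hY hfZ p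
  have J2 := jacobi_mlieBracket hX hY hZ p
  have hXZ := hX.lieBracket hZ
  have hYZ := hY.lieBracket hZ
  rw [key hf, key hf, key hf, Pi.add_apply, mlieBracket_add_right, mlieBracket_add_right, key2 hYf hZ, key2 hXf hZ,
    key2 hf hYZ, key2 hf hXZ, J2] at J1
  rotate_left
  · exact IsSmoothField.diffAt (hXf.smul_section hZ) p
  · exact IsSmoothField.diffAt (hf.smul_section hXZ) p
  · exact IsSmoothField.diffAt (hYf.smul_section hZ) p
  · exact IsSmoothField.diffAt (hf.smul_section hYZ) p
  have sm : ∀ (g : M → ℝ) (U : (p : M) → TangentSpace (𝓡 6) p), (g • U) p = g p • U p :=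
    fun _ _ => rfl
  rw [← sub_eq_zero, sm, sm] at J1
  have : (mvfderiv (𝓡 6) (fun q => mvfderiv (𝓡 6) f q (Y q)) p (X p) -
      mvfderiv (𝓡 6) (fun q => mvfderiv (𝓡 6) f q (X q)) p (Y p) -
      mvfderiv (𝓡 6) f p (mlieBracket (𝓡 6) X Y p)) • Z p = 0 := by
    rw [← J1]; module
  have := (smul_eq_zero.1 this).resolve_right hv
  linarith

end Manifold

/-! ### Curvature of a connection with parallel torsion, and the Bianchi identity. -/

section Manifold
variable {M : Type*} [TopologicalSpace M] [ChartedSpace R6 M] [IsManifold (𝓡 6) ∞ M]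
variable {X Y Z W : (p : M) → TangentSpace (𝓡 6) p}
  {cov : CovariantDerivative (𝓡 6) R6 (TangentSpace (𝓡 6) : M → Type)}
  {J : (p : M) → TangentSpace (𝓡 6) p →L[ℝ] TangentSpace (𝓡 6) p}

/-- The curvature `R(X, Y) Z` of a connection. -/
def curv (cov : CovariantDerivative (𝓡 6) R6 (TangentSpace (𝓡 6) : M → Type))
    (X Y Z : (p : M) → TangentSpace (𝓡 6) p) (p : M) : TangentSpace (𝓡 6) p :=
  cov (fun q => cov Z q (Y q)) p (X p) - cov (fun q => cov Z q (X q)) p (Y p)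
    - cov Z p (mlieBracket (𝓡 6) X Y p)

theorem cov_add (hX : IsSmoothField X) (hY : IsSmoothField Y) (p : M) :
    cov (fun q => X q + Y q) p = cov X p + cov Y p :=
  cov.isCovariantDerivativeOn.add (s := Set.univ) (hX.diffAt p) (hY.diffAt p)

theorem IsSmoothField.add (hX : IsSmoothField X) (hY : IsSmoothField Y) :
    IsSmoothField fun q => X q + Y q := ContMDiff.add_section hX hY

theorem IsSmoothField.sub (hX : IsSmoothField X) (hY : IsSmoothField Y) :
    IsSmoothField fun q => X q - Y q := ContMDiff.sub_section hX hY

theorem IsSmoothField.covDeriv (hs : cov.ContMDiffCovariantDerivative ∞) (hX : IsSmoothField X)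
    (hY : IsSmoothField Y) : IsSmoothField fun q => cov Y q (X q) := by
  have h := hs.contMDiff.contMDiff (σ := Y) (by simpa using! hY.contMDiffOn)
  rw [contMDiffOn_univ] at h
  exact ContMDiff.clm_bundle_apply (F₁ := R6) (F₂ := R6)
    (E₁ := (TangentSpace (𝓡 6) : M → Type)) (E₂ := (TangentSpace (𝓡 6) : M → Type)) h hX

theorem IsSmoothField.apply_J [RiemannianBundle (TangentSpace (𝓡 6) : M → Type)]
    (hJ : IsOrthogonalAlmostComplex J) (hX : IsSmoothField X) :
    IsSmoothField fun q => J q (X q) :=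
  ContMDiff.clm_bundle_apply (F₁ := R6) (F₂ := R6)
    (E₁ := (TangentSpace (𝓡 6) : M → Type)) (E₂ := (TangentSpace (𝓡 6) : M → Type)) hJ.smooth hX

theorem IsDiffFieldAt.apply_J [RiemannianBundle (TangentSpace (𝓡 6) : M → Type)]
    (hJ : IsOrthogonalAlmostComplex J) {p : M} (hX : IsDiffFieldAt X p) :
    IsDiffFieldAt (fun q => J q (X q)) p :=
  MDifferentiableAt.clm_bundle_apply (F₁ := R6) (F₂ := R6)
    (E₁ := (TangentSpace (𝓡 6) : M → Type)) (E₂ := (TangentSpace (𝓡 6) : M → Type))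
    ((hJ.smooth p).mdifferentiableAt (by simp)) hX

theorem IsSmoothField.torsion (hs : cov.ContMDiffCovariantDerivative ∞) (hX : IsSmoothField X)
    (hY : IsSmoothField Y) : IsSmoothField fun q => cov.torsion q (X q) (Y q) := by
  have : (fun q => cov.torsion q (X q) (Y q)) =
      fun q => cov Y q (X q) - cov X q (Y q) - mlieBracket (𝓡 6) X Y q := by
    ext1 q
    exact cov.torsion_apply (hX.diffAt q) (hY.diffAt q)
  rw [this]
  exact ((hX.covDeriv hs hY).sub (hY.covDeriv hs hX)).sub (hX.lieBracket hY)

variable [RiemannianBundle (TangentSpace (𝓡 6) : M → Type)]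
  [IsContMDiffRiemannianBundle (𝓡 6) ∞ R6 (TangentSpace (𝓡 6) : M → Type)]

instance : IsContMDiffRiemannianBundle (𝓡 6) 1 R6 (TangentSpace (𝓡 6) : M → Type) :=
  IsContMDiffRiemannianBundle.of_le (n := ∞) ENat.LEInfty.out

theorem IsSmoothField.inner (hX : IsSmoothField X) (hY : IsSmoothField Y) :
    ContMDiff (𝓡 6) 𝓘(ℝ) ∞ fun q => inner ℝ (X q) (Y q) := ContMDiff.inner_bundle hX hY

theorem mvfderiv_inner (hm : cov.IsMetricCompatible) {p : M} (hX : IsDiffFieldAt X p)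
    (hY : IsDiffFieldAt Y p) (w : TangentSpace (𝓡 6) p) :
    mvfderiv (𝓡 6) (fun q => inner ℝ (X q) (Y q)) p w =
      inner ℝ (cov X p w) (Y p) + inner ℝ (X p) (cov Y p w) := by
  have := hm.mvfderiv_inner_eq (FiberBundle.extend R6 w) hX hY
  simpa using this

/-- The function g(Z, W) is differentiated twice. The mixed terms are symmetric in `X` and `Y`, so
they drop out of the commutator. -/
theorem inner_curv_skew [T2Space M] (hs : cov.ContMDiffCovariantDerivative ∞)
    (hm : cov.IsMetricCompatible) (hX : IsSmoothField X) (hY : IsSmoothField Y)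
    (hZ : IsSmoothField Z) (hW : IsSmoothField W) (p : M) :
    inner ℝ (curv cov X Y Z p) (W p) = -inner ℝ (Z p) (curv cov X Y W p) := by
  have hd : ∀ {V : (p : M) → TangentSpace (𝓡 6) p}, IsSmoothField V →
      (fun q => mvfderiv (𝓡 6) (fun q => inner ℝ (Z q) (W q)) q (V q)) =
        fun q => inner ℝ (cov Z q (V q)) (W q) + inner ℝ (Z q) (cov W q (V q)) := fun hV => by
    ext1 q
    exact mvfderiv_inner hm (hZ.diffAt q) (hW.diffAt q) _
  have hsm : ∀ {V : (p : M) → TangentSpace (𝓡 6) p}, IsSmoothField V →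
      ContMDiff (𝓡 6) 𝓘(ℝ) ∞
        (fun q => mvfderiv (𝓡 6) (fun q => inner ℝ (Z q) (W q)) q (V q)) := fun hV => by
    rw [hd hV]
    exact ((hV.covDeriv hs hZ).inner hW).add (hZ.inner (hV.covDeriv hs hW))
  have hdd : ∀ {V U : (p : M) → TangentSpace (𝓡 6) p}, IsSmoothField V → IsSmoothField U →
      mvfderiv (𝓡 6) (fun q => mvfderiv (𝓡 6) (fun q => inner ℝ (Z q) (W q)) q (V q)) p (U p) =
        inner ℝ (cov (fun q => cov Z q (V q)) p (U p)) (W p) +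
        inner ℝ (cov Z p (V p)) (cov W p (U p)) + (inner ℝ (cov Z p (U p)) (cov W p (V p)) +
        inner ℝ (Z p) (cov (fun q => cov W q (V q)) p (U p))) := fun hV hU => by
    rw [hd hV, mvfderiv_fun_add
      ((((hV.covDeriv hs hZ).inner hW) p).mdifferentiableAt (by simp))
      (((hZ.inner (hV.covDeriv hs hW)) p).mdifferentiableAt (by simp)), add_apply,
      mvfderiv_inner hm ((hV.covDeriv hs hZ).diffAt p) (hW.diffAt p),
      mvfderiv_inner hm (hZ.diffAt p) ((hV.covDeriv hs hW).diffAt p)]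
  have h := mvfderiv_mlieBracket hX hY (hZ.inner hW) (hsm hX) (hsm hY) p
  rw [hdd hX hY, hdd hY hX, mvfderiv_inner hm (hZ.diffAt p) (hW.diffAt p)] at h
  simp only [curv, inner_sub_left, inner_sub_right]
  linarith

theorem curv_J (hc : IsCharacteristicConnection J cov)
    (hX : IsSmoothField X) (hY : IsSmoothField Y) (hZ : IsSmoothField Z) (p : M) :
    curv cov X Y (fun q => J q (Z q)) p = J p (curv cov X Y Z p) := by
  have h : ∀ {V : (p : M) → TangentSpace (𝓡 6) p}, IsSmoothField V →
      (fun q => cov (fun q => J q (Z q)) q (V q)) = fun q => J q (cov Z q (V q)) := fun hV => by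
    ext1 q; exact hc.complex q _ Z (hZ.diffAt q)
  simp only [curv, h hX, h hY, map_sub, hc.complex p _ Z (hZ.diffAt p),
    hc.complex p _ _ ((hX.covDeriv hc.smooth hZ).diffAt p),
    hc.complex p _ _ ((hY.covDeriv hc.smooth hZ).diffAt p)]

/-- Parallelism of the (3,0)-tensor with the third argument removed by the metric: a Leibniz rule
for the vector-valued torsion. -/
theorem cov_torsion [T2Space M] (hs : cov.ContMDiffCovariantDerivative ∞)
    (hm : cov.IsMetricCompatible)
    (hp : HasParallelTorsion cov) (hX : IsSmoothField X) (hY : IsSmoothField Y) (p : M)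
    (w : TangentSpace (𝓡 6) p) :
    cov (fun q => cov.torsion q (X q) (Y q)) p w =
      cov.torsion p (cov X p w) (Y p) + cov.torsion p (X p) (cov Y p w) := by
  refine ext_inner_right ℝ fun v => ?_
  obtain ⟨Z, hZ, rfl⟩ := exists_isSmoothField p v
  have h := hp p w X Y Z (hX.diffAt p) (hY.diffAt p) (hZ.diffAt p)
  simp only [torsionForm] at h
  rw [mvfderiv_inner hm ((hX.torsion hs hY).diffAt p) (hZ.diffAt p)] at h
  rw [inner_add_left]
  linarith

/-- Two applications of the Leibniz rule; the cross terms are symmetric in `X` and `Y`. Thus the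
curvature operators annihilate the torsion. -/
theorem curv_torsion [T2Space M] (hs : cov.ContMDiffCovariantDerivative ∞)
    (hm : cov.IsMetricCompatible)
    (hp : HasParallelTorsion cov) (hX : IsSmoothField X) (hY : IsSmoothField Y)
    (hZ : IsSmoothField Z) (hW : IsSmoothField W) (p : M) :
    curv cov X Y (fun q => cov.torsion q (Z q) (W q)) p =
      cov.torsion p (curv cov X Y Z p) (W p) + cov.torsion p (Z p) (curv cov X Y W p) := by
  have h : ∀ {V : (p : M) → TangentSpace (𝓡 6) p}, IsSmoothField V →
      (fun q => cov (fun q => cov.torsion q (Z q) (W q)) q (V q)) =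
        fun q => cov.torsion q (cov Z q (V q)) (W q) + cov.torsion q (Z q) (cov W q (V q)) :=
    fun hV => by ext1 q; exact cov_torsion hs hm hp hZ hW q _
  have h2 : ∀ {V U : (p : M) → TangentSpace (𝓡 6) p}, IsSmoothField V → IsSmoothField U →
      cov (fun q => cov (fun q => cov.torsion q (Z q) (W q)) q (V q)) p (U p) =
        cov.torsion p (cov (fun q => cov Z q (V q)) p (U p)) (W p) +
        cov.torsion p (cov Z p (V p)) (cov W p (U p)) +
        (cov.torsion p (cov Z p (U p)) (cov W p (V p)) +
        cov.torsion p (Z p) (cov (fun q => cov W q (V q)) p (U p))) := fun hV hU => by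
    rw [h hV, cov_add ((hV.covDeriv hs hZ).torsion hs hW) (hZ.torsion hs (hV.covDeriv hs hW)),
      add_apply, cov_torsion hs hm hp (hV.covDeriv hs hZ) hW,
      cov_torsion hs hm hp hZ (hV.covDeriv hs hW)]
  unfold curv
  rw [h2 hX hY, h2 hY hX, cov_torsion hs hm hp hZ hW]
  simp only [map_sub, sub_apply]
  abel

/-- The first Bianchi identity of a connection with parallel torsion. -/
theorem bianchi [T2Space M] (hs : cov.ContMDiffCovariantDerivative ∞)
    (hm : cov.IsMetricCompatible)
    (hp : HasParallelTorsion cov) (hX : IsSmoothField X) (hY : IsSmoothField Y)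
    (hZ : IsSmoothField Z) (p : M) :
    curv cov X Y Z p + curv cov Y Z X p + curv cov Z X Y p =
      cov.torsion p (cov.torsion p (X p) (Y p)) (Z p) +
      cov.torsion p (cov.torsion p (Y p) (Z p)) (X p) +
      cov.torsion p (cov.torsion p (Z p) (X p)) (Y p) := by
  -- The torsion exchanges the two arguments of `cov`. Differentiating this rule in `h2` produces no
  -- derivative of the torsion, which is parallel.
  have h : ∀ {U V : (p : M) → TangentSpace (𝓡 6) p}, IsSmoothField U → IsSmoothField V →
      (fun q => cov V q (U q)) = fun q => (cov.torsion q (U q) (V q) + cov U q (V q)) +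
        mlieBracket (𝓡 6) U V q := fun {U V} hU hV => by
    ext1 q; rw [cov.torsion_apply (hU.diffAt q) (hV.diffAt q)]; abel
  have h2 : ∀ {U V V' : (p : M) → TangentSpace (𝓡 6) p}, IsSmoothField U → IsSmoothField V →
      IsSmoothField V' → cov (fun q => cov V q (U q)) p (V' p) =
        cov.torsion p (cov U p (V' p)) (V p) - cov.torsion p (cov V p (V' p)) (U p) +
        cov (fun q => cov U q (V q)) p (V' p) + cov (mlieBracket (𝓡 6) U V) p (V' p) :=
    fun {U V V'} hU hV hV' => by
      rw [h hU hV, cov_add ((hU.torsion hs hV).add (hV.covDeriv hs hU)) (hU.lieBracket hV),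
        cov_add (hU.torsion hs hV) (hV.covDeriv hs hU), add_apply,
        add_apply, cov_torsion hs hm hp hU hV, cov.torsion_antisymm (U p), sub_eq_add_neg]
  -- The same exchange for a field differentiated along `V'`, when that field is a bracket; the
  -- double brackets it leaves cancel by Jacobi.
  have h3 : ∀ {U V V' : (p : M) → TangentSpace (𝓡 6) p}, IsSmoothField U → IsSmoothField V →
      IsSmoothField V' → cov (mlieBracket (𝓡 6) U V) p (V' p) =
        -cov.torsion p (mlieBracket (𝓡 6) U V p) (V' p) + cov V' p (mlieBracket (𝓡 6) U V p) +
        mlieBracket (𝓡 6) V' (mlieBracket (𝓡 6) U V) p := fun {U V V'} hU hV hV' => by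
    rw [← cov.torsion_antisymm, cov.torsion_apply (hV'.diffAt p) ((hU.lieBracket hV).diffAt p)]; abel
  have hJ := jacobi_mlieBracket hX hY hZ p
  have e1 := mlieBracket_swap_apply (I := 𝓡 6) (V := mlieBracket (𝓡 6) X Y) (W := Z) (x := p)
  have t1 := cov.torsion_apply (hX.diffAt p) (hY.diffAt p)
  have t2 := cov.torsion_apply (hY.diffAt p) (hZ.diffAt p)
  have t3 := cov.torsion_apply (hZ.diffAt p) (hX.diffAt p)
  have e4 : mlieBracket (𝓡 6) Y (mlieBracket (𝓡 6) Z X) p =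
      - mlieBracket (𝓡 6) Y (mlieBracket (𝓡 6) X Z) p := by
    have := mlieBracket_const_smul_right (I := 𝓡 6) (V := Y) (c := (-1 : ℝ))
      ((hX.lieBracket hZ).diffAt p)
    rw [mlieBracket_swap (V := Z)]
    simpa using this
  simp only [curv, h2 hX hY hZ, h2 hY hZ hX, h2 hZ hX hY, h3 hX hY hZ, h3 hY hZ hX, h3 hZ hX hY,
    t1, t2, t3, map_sub, sub_apply, e4, hJ, e1]
  abel

end Manifold

/-! ### The Levi-Civita connection, the intrinsic torsion and dT in terms of the torsion. -/

section Manifold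
variable {M : Type*} [TopologicalSpace M] [ChartedSpace R6 M] [IsManifold (𝓡 6) ∞ M]
variable {X Y Z W : (p : M) → TangentSpace (𝓡 6) p}
  {cov : CovariantDerivative (𝓡 6) R6 (TangentSpace (𝓡 6) : M → Type)}
  {J : (p : M) → TangentSpace (𝓡 6) p →L[ℝ] TangentSpace (𝓡 6) p}
variable [RiemannianBundle (TangentSpace (𝓡 6) : M → Type)]

theorem torsionForm_swap (p : M) (x y z : TangentSpace (𝓡 6) p) :
    torsionForm cov p x y z = -torsionForm cov p y x z := by
  rw [torsionForm, cov.torsion_antisymm, inner_neg_left, torsionForm]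

/-- The 4-form `σ_T(x, y, z, w)`, the cyclic sum over `x, y, z` of `g(T(x, y), T(z, w))`. -/
def sigmaForm (cov : CovariantDerivative (𝓡 6) R6 (TangentSpace (𝓡 6) : M → Type)) (p : M)
    (x y z w : TangentSpace (𝓡 6) p) : ℝ :=
  inner ℝ (cov.torsion p x y) (cov.torsion p z w)
  + inner ℝ (cov.torsion p y z) (cov.torsion p x w)
  + inner ℝ (cov.torsion p z x) (cov.torsion p y w)

variable [IsContMDiffRiemannianBundle (𝓡 6) ∞ R6 (TangentSpace (𝓡 6) : M → Type)]

theorem IsCharacteristicConnection.torsionForm_torsion (hc : IsCharacteristicConnection J cov)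
    (p : M) (x y z w : TangentSpace (𝓡 6) p) :
    torsionForm cov p (cov.torsion p x y) z w =
      inner ℝ (cov.torsion p x y) (cov.torsion p z w) := by
  rw [torsionForm_swap, hc.skew, neg_neg, torsionForm, real_inner_comm]

/-- Because the torsion is totally skew, ∇^c - T/2 is still metric and is torsion free, so it must
agree with the Koszul formula. -/
theorem IsCharacteristicConnection.leviCivita_eq (hc : IsCharacteristicConnection J cov) {p : M}
    (hX : IsDiffFieldAt X p) (hY : IsDiffFieldAt Y p) (hZ : IsDiffFieldAt Z p) :
    leviCivita X Y Z p =
      inner ℝ (cov Y p (X p)) (Z p) - 1 / 2 * torsionForm cov p (X p) (Y p) (Z p) := by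
  have b1 := cov.torsion_apply hX hY
  have b2 := cov.torsion_apply hX hZ
  have b3 := cov.torsion_apply hY hZ
  rw [eq_sub_iff_add_eq, ← eq_sub_iff_add_eq'] at b1 b2 b3
  have s1 := hc.skew p (X p) (Z p) (Y p)
  have s2 : torsionForm cov p (Y p) (Z p) (X p) = torsionForm cov p (X p) (Y p) (Z p) := by
    rw [hc.skew, torsionForm_swap, neg_neg]
  rw [leviCivita, mvfderiv_inner hc.metric hY hZ, mvfderiv_inner hc.metric hX hZ,
    mvfderiv_inner hc.metric hX hY, b1, b2, b3]
  simp only [inner_sub_left]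
  simp only [torsionForm] at *
  rw [s1, s2, real_inner_comm (X p), real_inner_comm (Y p) (cov Z p (X p)),
    real_inner_comm (X p)]
  ring

/-- As `J` is parallel and orthogonal, the two `cov` terms coincide and cancel; only the torsion
terms remain, with factor 1/2 · 1/2. -/
theorem IsCharacteristicConnection.intrinsicTorsion_eq (hJ : IsOrthogonalAlmostComplex J)
    (hc : IsCharacteristicConnection J cov) (p : M) (x y z : TangentSpace (𝓡 6) p) :
    intrinsicTorsion J p x y z =
      -(1 / 4) * (torsionForm cov p x y z - torsionForm cov p x (J p y) (J p z)) := by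
  have hd : ∀ v : TangentSpace (𝓡 6) p, IsDiffFieldAt (FiberBundle.extend R6 v) p :=
    fun v => FiberBundle.mdifferentiableAt_extend (𝓡 6) R6 v
  rw [intrinsicTorsion, hc.leviCivita_eq (hd x) (hd y) (hd z),
    hc.leviCivita_eq (hd x) ((hd y).apply_J hJ) ((hd z).apply_J hJ), hc.complex p _ _ (hd y),
    hJ.orthogonal]
  simp only [FiberBundle.extend_apply_self]
  ring

/-- Derivatives become `cov` terms by parallelism, brackets become `cov` terms minus torsion. All
`cov` terms cancel, and the six bracket terms give each of the three products in σ twice. -/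
theorem IsCharacteristicConnection.extDerivThree_eq (hc : IsCharacteristicConnection J cov)
    (hp : HasParallelTorsion cov) {p : M}
    (hX : IsDiffFieldAt X p) (hY : IsDiffFieldAt Y p) (hZ : IsDiffFieldAt Z p)
    (hW : IsDiffFieldAt W p) :
    extDerivThree (torsionForm cov) X Y Z W p = 2 * sigmaForm cov p (X p) (Y p) (Z p) (W p) := by
  have br : ∀ {U V : (p : M) → TangentSpace (𝓡 6) p}, IsDiffFieldAt U p → IsDiffFieldAt V p →
      ∀ x y, torsionForm cov p (mlieBracket (𝓡 6) U V p) x y =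
        torsionForm cov p (cov V p (U p)) x y - torsionForm cov p (cov U p (V p)) x y
        - inner ℝ (cov.torsion p (U p) (V p)) (cov.torsion p x y) := fun hU hV x y => by
    rw [← hc.torsionForm_torsion, cov.torsion_apply hU hV]
    simp only [torsionForm, map_sub, sub_apply, inner_sub_left]
    ring
  have c1 : ∀ x y z, torsionForm cov p y x z = -torsionForm cov p x y z := fun x y z =>
    torsionForm_swap p y x z
  have c2 : ∀ x y z, torsionForm cov p y z x = torsionForm cov p x y z := fun x y z => by
    rw [hc.skew, torsionForm_swap, neg_neg]
  rw [extDerivThree, hp p _ Y Z W hY hZ hW, hp p _ X Z W hX hZ hW, hp p _ X Y W hX hY hW,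
    hp p _ X Y Z hX hY hZ, br hX hY, br hX hZ, br hX hW, br hY hZ, br hY hW, br hZ hW]
  rw [c2 (cov W p (X p)), c2 (cov W p (Y p)), c2 (cov W p (Z p)), c2 (cov Z p (W p)),
    c1 (cov Z p (X p)), c1 (cov Z p (Y p)), c1 (cov Y p (Z p)), c1 (cov Y p (W p))]
  rw [sigmaForm, cov.torsion_antisymm (Z p) (X p), inner_neg_left,
    real_inner_comm (cov.torsion p (X p) (Y p)) (cov.torsion p (Z p) (W p)),
    real_inner_comm (cov.torsion p (X p) (Z p)) (cov.torsion p (Y p) (W p)),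
    real_inner_comm (cov.torsion p (X p) (W p)) (cov.torsion p (Y p) (Z p))]
  ring

theorem IsCharacteristicConnection.isClosedThree_iff (hc : IsCharacteristicConnection J cov)
    (hp : HasParallelTorsion cov) :
    IsClosedThree (torsionForm cov) ↔ ∀ (p : M) (x y z w : TangentSpace (𝓡 6) p),
      sigmaForm cov p x y z w = 0 := by
  refine ⟨fun h p x y z w => ?_, fun h p X Y Z W hX hY hZ hW => ?_⟩
  · have hd : ∀ v : TangentSpace (𝓡 6) p, IsDiffFieldAt (FiberBundle.extend R6 v) p :=
      fun v => FiberBundle.mdifferentiableAt_extend (𝓡 6) R6 v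
    have := h p _ _ _ _ (FiberBundle.contMDiffAt_extend (𝓡 6) R6 x)
      (FiberBundle.contMDiffAt_extend (𝓡 6) R6 y) (FiberBundle.contMDiffAt_extend (𝓡 6) R6 z)
      (FiberBundle.contMDiffAt_extend (𝓡 6) R6 w)
    rw [hc.extDerivThree_eq hp (hd x) (hd y) (hd z) (hd w)] at this
    simpa using this
  · rw [hc.extDerivThree_eq hp (hX.mdifferentiableAt (by simp)) (hY.mdifferentiableAt (by simp))
      (hZ.mdifferentiableAt (by simp)) (hW.mdifferentiableAt (by simp)), h, mul_zero]

end Manifold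

/-! ### Unitary frames diagonalising an operator that commutes with J. -/

section LinearAlgebra

variable {V : Type*} [NormedAddCommGroup V] [InnerProductSpace ℝ V]

/-- An orthogonal complex structure on an inner product space. -/
structure IsOrthogonalComplex (J : V →ₗ[ℝ] V) : Prop where
  sq : ∀ x, J (J x) = -x
  orthogonal : ∀ x y, inner ℝ (J x) (J y) = inner ℝ x y

/-- An orthonormal family with `g(J e_i, e_j) = Ω_ij`. -/
structure IsUnitaryFrame (J : V →ₗ[ℝ] V) (e : Fin 6 → V) : Prop where
  orthonormal : Orthonormal ℝ e
  kahler : ∀ i j, inner ℝ (J (e i)) (e j) = Om i j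

variable {J : V →ₗ[ℝ] V}

theorem IsOrthogonalComplex.inner_left (hJ : IsOrthogonalComplex J) (x y : V) :
    inner ℝ (J x) y = -inner ℝ x (J y) := by
  rw [← hJ.orthogonal x, hJ.sq, inner_neg_right, neg_neg]

theorem IsOrthogonalComplex.inner_self (hJ : IsOrthogonalComplex J) (x : V) :
    inner ℝ (J x) x = 0 := by
  have h := hJ.inner_left x x
  rw [real_inner_comm] at h ⊢
  linarith

theorem IsOrthogonalComplex.norm (hJ : IsOrthogonalComplex J) (x : V) : ‖J x‖ = ‖x‖ := by
  rw [norm_eq_sqrt_real_inner, hJ.orthogonal, ← norm_eq_sqrt_real_inner]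

/-- The restriction of `H` to `K` is symmetric, so the supremum of its Rayleigh quotient is an
eigenvalue. -/
theorem exists_unit_eigenvector [FiniteDimensional ℝ V] {H : V →ₗ[ℝ] V} (hH : H.IsSymmetric)
    {K : Submodule ℝ V} (hK : K ≠ ⊥) (hHK : ∀ x ∈ K, H x ∈ K) :
    ∃ v ∈ K, ‖v‖ = 1 ∧ ∃ c : ℝ, H v = c • v := by
  have : Nontrivial K := Submodule.nontrivial_iff_ne_bot.2 hK
  obtain ⟨c, hc⟩ : ∃ c : ℝ, Module.End.HasEigenvalue (H.restrict hHK) c :=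
    ⟨_, (hH.restrict_invariant hHK).hasEigenvalue_iSup_of_finiteDimensional⟩
  obtain ⟨w, hw⟩ := hc.exists_hasEigenvector
  have hw0 : (w : V) ≠ 0 := by simpa using hw.2
  have hw1 : H w = c • (w : V) := congrArg Subtype.val hw.apply_eq_smul
  refine ⟨‖(w : V)‖⁻¹ • (w : V), K.smul_mem _ w.2, ?_, c, ?_⟩
  · rw [norm_smul, norm_inv, norm_norm, inv_mul_cancel₀ (norm_ne_zero_iff.2 hw0)]
  · rw [map_smul, hw1, smul_comm]

/-- The vectors `u i` and `J (u i)` span at most 2n < 6 dimensions, and the orthogonal complement is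
`H`-invariant because `H` is symmetric and commutes with `J`. -/
theorem exists_unit_eigenvector_orthogonal [FiniteDimensional ℝ V]
    (hV : Module.finrank ℝ V = 6) {H : V →ₗ[ℝ] V}
    (hH : H.IsSymmetric) (hHJ : ∀ x, H (J x) = J (H x)) {n : ℕ} (hn : n < 3) (u : Fin n → V)
    (hu : ∀ i, ∃ c : ℝ, H (u i) = c • u i) :
    ∃ v : V, ‖v‖ = 1 ∧ (∃ c : ℝ, H v = c • v) ∧
      ∀ i, inner ℝ (u i) v = 0 ∧ inner ℝ (J (u i)) v = 0 := by
  set f : Fin n ⊕ Fin n → V := Sum.elim u fun i => J (u i)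
  have hmem : ∀ x, x ∈ (Submodule.span ℝ (Set.range f))ᗮ ↔
      ∀ i, inner ℝ (u i) x = 0 ∧ inner ℝ (J (u i)) x = 0 := by
    intro x
    rw [Submodule.mem_orthogonal]
    constructor
    · exact fun h i => ⟨h _ (Submodule.subset_span ⟨Sum.inl i, rfl⟩),
        h _ (Submodule.subset_span ⟨Sum.inr i, rfl⟩)⟩
    · intro h w hw
      induction hw using Submodule.span_induction with
      | mem y hy =>
        obtain ⟨i | i, rfl⟩ := hy
        exacts [(h i).1, (h i).2]
      | zero => simp
      | add y z _ _ hy hz => rw [inner_add_left, hy, hz, add_zero]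
      | smul a y _ hy => rw [inner_smul_left, hy, mul_zero]
  have hne : (Submodule.span ℝ (Set.range f))ᗮ ≠ ⊥ := by
    intro h
    have h1 := (Submodule.span ℝ (Set.range f)).finrank_add_finrank_orthogonal
    have h2 := finrank_range_le_card (R := ℝ) f
    rw [h, finrank_bot, hV] at h1
    simp only [Set.finrank, Fintype.card_sum, Fintype.card_fin] at h2
    omega
  obtain ⟨v, hv, hv1, hv2⟩ := exists_unit_eigenvector hH hne fun x hx => by
    rw [hmem] at hx ⊢
    intro i
    obtain ⟨c, hc⟩ := hu i
    rw [← hH, ← hH, hHJ, hc, map_smul, inner_smul_left, inner_smul_left, (hx i).1, (hx i).2]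
    simp
  exact ⟨v, hv1, hv2, (hmem v).1 hv⟩

/-- A symmetric operator commuting with `J` is diagonalised by a unitary frame, whose fifth vector
may be any unit eigenvector. -/
theorem exists_unitaryFrame [FiniteDimensional ℝ V]
    (hV : Module.finrank ℝ V = 6) (hJ : IsOrthogonalComplex J) {H : V →ₗ[ℝ] V}
    (hH : H.IsSymmetric) (hHJ : ∀ x, H (J x) = J (H x)) {v : V} (hv : ‖v‖ = 1)
    (hHv : ∃ c : ℝ, H v = c • v) :
    ∃ e : Fin 6 → V, IsUnitaryFrame J e ∧ e 4 = v ∧ e 1 = J (e 0) ∧ e 3 = J (e 2) ∧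
      e 5 = J (e 4) ∧ (∃ c : ℝ, H (e 0) = c • e 0) ∧ (∃ c : ℝ, H (e 2) = c • e 2) := by
  obtain ⟨w, hw, hHw, hvw⟩ := exists_unit_eigenvector_orthogonal hV hH hHJ (by norm_num) ![v]
    (by simpa [Fin.forall_fin_succ] using hHv)
  obtain ⟨x, hx, hHx, hvx⟩ := exists_unit_eigenvector_orthogonal hV hH hHJ (by norm_num) ![v, w]
    (by simpa [Fin.forall_fin_succ] using ⟨hHv, hHw⟩)
  simp only [Fin.forall_fin_succ, Matrix.cons_val_zero, Matrix.cons_val_succ, IsEmpty.forall_iff,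
    and_true] at hvw hvx
  obtain ⟨a1, a2⟩ := hvw
  obtain ⟨⟨b1, b2⟩, c1, c2⟩ := hvx
  have n1 : inner ℝ v v = (1 : ℝ) := by simp [hv]
  have n2 : inner ℝ w w = (1 : ℝ) := by simp [hw]
  have n3 : inner ℝ x x = (1 : ℝ) := by simp [hx]
  have s := hJ.inner_self
  have s' : ∀ y, inner ℝ y (J y) = 0 := fun y => by rw [real_inner_comm, s]
  have a3 : inner ℝ w (J v) = 0 := by rw [real_inner_comm, a2]
  have b3 : inner ℝ x (J v) = 0 := by rw [real_inner_comm, b2]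
  have c3 : inner ℝ x (J w) = 0 := by rw [real_inner_comm, c2]
  have a1' : inner ℝ w v = 0 := by rw [real_inner_comm, a1]
  have b1' : inner ℝ x v = 0 := by rw [real_inner_comm, b1]
  have c1' : inner ℝ x w = 0 := by rw [real_inner_comm, c1]
  have a4 : inner ℝ v (J w) = 0 := by simpa [a2] using hJ.inner_left v w
  have b4 : inner ℝ v (J x) = 0 := by simpa [b2] using hJ.inner_left v x
  have c4 : inner ℝ w (J x) = 0 := by simpa [c2] using hJ.inner_left w x
  have a5 : inner ℝ (J w) v = 0 := by rw [real_inner_comm, a4]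
  have b5 : inner ℝ (J x) v = 0 := by rw [real_inner_comm, b4]
  have c5 : inner ℝ (J x) w = 0 := by rw [real_inner_comm, c4]
  refine ⟨![w, J w, x, J x, v, J v], ⟨?_, ?_⟩, rfl, rfl, rfl, rfl, hHw, hHx⟩
  · rw [orthonormal_iff_ite]
    intro i j
    fin_cases i <;> fin_cases j <;>
      simp [hJ.orthogonal, hJ.norm, hv, hw, hx, s, s', a1, a2, a3, a4, a5, a1', b1, b2, b3, b4, b5, b1',
        c1, c2, c3, c4, c5, c1']
  · intro i j
    fin_cases i <;> fin_cases j <;>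
      simp [hJ.orthogonal, hJ.norm, hJ.sq, hv, hw, hx, s, s', a1, a2, a3, a4, a5, a1', b1, b2, b3, b4, b5,
        b1', c1, c2, c3, c4, c5, c1', Om]

end LinearAlgebra

/-! ### Stabilizers of 3-forms and the trace of σ, in components. -/

section Components

/-- Components of a 3-form. -/
def IsSkew (t : Fin 6 → Fin 6 → Fin 6 → ℝ) : Prop :=
  ∀ i j k, t i j k = -t j i k ∧ t i j k = -t i k j

/-- Components of `σ_T`. -/
def sig (t : Fin 6 → Fin 6 → Fin 6 → ℝ) (i j k l : Fin 6) : ℝ :=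
  ∑ m, (t i j m * t k l m + t j k m * t i l m + t k i m * t j l m)

/-- Half of the pairing of `σ_T` with `Ω ∧ Ω`. -/
def sigTrace (t : Fin 6 → Fin 6 → Fin 6 → ℝ) : ℝ :=
  sig t 0 1 2 3 + sig t 0 1 4 5 + sig t 2 3 4 5

/-- Components of the trace of a 3-form with `Ω`. -/
def leeVec (t : Fin 6 → Fin 6 → Fin 6 → ℝ) (k : Fin 6) : ℝ := t 0 1 k + t 2 3 k + t 4 5 k

/-- The skew-hermitian matrix `a` annihilates the 3-form `t`. -/
structure IsStabilizer (t : Fin 6 → Fin 6 → Fin 6 → ℝ) (a : Fin 6 → Fin 6 → ℝ) : Prop where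
  skew : ∀ i j, a i j = -a j i
  comm : ∀ i j, ∑ m, Om i m * a m j = ∑ m, a i m * Om m j
  deriv : ∀ i j k, ∑ m, (a i m * t m j k + a j m * t i m k + a k m * t i j m) = 0

variable {t : Fin 6 → Fin 6 → Fin 6 → ℝ} {a : Fin 6 → Fin 6 → ℝ}

theorem IsSkew.swap_left (ht : IsSkew t) {i j : Fin 6} (_ : i < j) (k : Fin 6) :
    t j i k = -t i j k := (ht j i k).1

theorem IsSkew.swap_right (ht : IsSkew t) {j k : Fin 6} (_ : j < k) (i : Fin 6) :
    t i k j = -t i j k := (ht i k j).2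

theorem IsSkew.self_left (ht : IsSkew t) (i k : Fin 6) : t i i k = 0 := by
  linarith [(ht i i k).1]

theorem IsSkew.self_right (ht : IsSkew t) (i k : Fin 6) : t i k k = 0 := by
  linarith [(ht i k k).2]

theorem IsStabilizer.self (ha : IsStabilizer t a) (i : Fin 6) : a i i = 0 := by
  linarith [ha.skew i i]

theorem IsStabilizer.swap (ha : IsStabilizer t a) {i j : Fin 6} (_ : i < j) : a j i = -a i j :=
  ha.skew j i

/-- Commuting with J makes each 2×2 block a complex number, determined by its first row. -/
theorem IsStabilizer.entries (ha : IsStabilizer t a) :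
    a 1 3 = a 0 2 ∧ a 1 2 = -a 0 3 ∧ a 1 5 = a 0 4 ∧ a 1 4 = -a 0 5 ∧ a 3 5 = a 2 4 ∧
      a 3 4 = -a 2 5 := by
  have h := ha.comm
  have h1 := h 0 3
  have h2 := h 0 2
  have h3 := h 0 5
  have h4 := h 0 4
  have h5 := h 2 5
  have h6 := h 2 4
  simp [Om, Fin.sum_univ_six] at h1 h2 h3 h4 h5 h6
  exact ⟨h1, h2, h3, h4, h5, h6⟩

/-- The trace of a 3-form is invariant under its stabilizer. -/
theorem IsStabilizer.sum_leeVec (ht : IsSkew t) (ha : IsStabilizer t a) (j : Fin 6) :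
    ∑ m, leeVec t m * a m j = 0 := by
  -- In the sum of these three equations the terms acting on the two traced indices cancel, because
  -- `a` commutes with Ω.
  have h1 := ha.deriv 0 1 j
  have h2 := ha.deriv 2 3 j
  have h3 := ha.deriv 4 5 j
  obtain ⟨e1, e2, e3, e4, e5, e6⟩ := ha.entries
  fin_cases j <;>
  · simp [leeVec, Fin.sum_univ_six, ht.swap_left, ht.swap_right, ht.self_left, ht.self_right,
      ha.self, ha.swap, e1, e2, e3, e4, e5, e6] at h1 h2 h3 ⊢
    linarith only [h1, h2, h3]

theorem IsSkew.eq_zero (ht : IsSkew t) (h : ∀ i j k, i < j → j < k → t i j k = 0) (i j k : Fin 6) :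
    t i j k = 0 := by
  have h2 : ∀ i j k, i < j → t i j k = 0 := fun i j k hij => by
    rcases lt_trichotomy j k with hjk | rfl | hjk
    · exact h i j k hij hjk
    · exact ht.self_right i j
    · rw [ht.swap_right hjk]
      rcases lt_trichotomy i k with hik | rfl | hik
      · rw [h i k j hik hjk, neg_zero]
      · rw [ht.self_left, neg_zero]
      · rw [ht.swap_left hik, h k i j hik hij, neg_zero, neg_zero]
  rcases lt_trichotomy i j with hij | rfl | hij
  · exact h2 i j k hij
  · exact ht.self_left i k
  · rw [ht.swap_left hij, h2 j i k hij, neg_zero]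

theorem sigTrace_expand (ht : IsSkew t) :
    sigTrace t = t 0 1 4 * t 2 3 4 + t 1 2 4 * t 0 3 4 - t 0 2 4 * t 1 3 4
      + t 0 1 5 * t 2 3 5 + t 1 2 5 * t 0 3 5 - t 0 2 5 * t 1 3 5
      + t 0 1 2 * t 2 4 5 + t 1 2 4 * t 0 2 5 - t 0 2 4 * t 1 2 5
      + t 0 1 3 * t 3 4 5 + t 1 3 4 * t 0 3 5 - t 0 3 4 * t 1 3 5
      + t 0 2 3 * t 0 4 5 + t 0 3 4 * t 0 2 5 - t 0 2 4 * t 0 3 5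
      + t 1 2 3 * t 1 4 5 + t 1 3 4 * t 1 2 5 - t 1 2 4 * t 1 3 5 := by
  simp [sigTrace, sig, Fin.sum_univ_six, ht.swap_left, ht.swap_right, ht.self_left, ht.self_right]
  ring

/-- `8 σ_T(Ω, Ω)` as a difference of squares when `T₆ = 0`. -/
theorem sigTrace_of_leeVec (ht : IsSkew t) (h6 : ∀ k, leeVec t k = 0) :
    8 * sigTrace t =
      3 * ((t 0 2 4 - t 0 3 5 - t 1 2 5 - t 1 3 4) ^ 2 + (t 0 2 5 + t 0 3 4 + t 1 2 4 - t 1 3 5) ^ 2)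
      - ((t 0 2 4 + t 0 3 5 + t 1 2 5 - t 1 3 4) ^ 2 + (t 0 3 4 + t 1 2 4 + t 1 3 5 - t 0 2 5) ^ 2)
      - ((t 0 2 4 + t 0 3 5 - t 1 2 5 + t 1 3 4) ^ 2 + (t 0 2 5 - t 0 3 4 + t 1 2 4 + t 1 3 5) ^ 2)
      - ((t 0 2 4 - t 0 3 5 + t 1 2 5 + t 1 3 4) ^ 2 + (t 0 2 5 + t 0 3 4 - t 1 2 4 + t 1 3 5) ^ 2)
      - 8 * (t 0 1 2 ^ 2 + t 0 1 3 ^ 2 + t 0 1 4 ^ 2 + t 0 1 5 ^ 2 + t 0 2 3 ^ 2 + t 1 2 3 ^ 2) := by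
  -- The squares with coefficient 3 are the (3,0)-part; the next three pairs are the parts with one
  -- of the three complex lines conjugated; the last six involve both vectors of one line, their
  -- partners in another line being opposite by `h6`.
  have h60 := h6 0
  have h61 := h6 1
  have h62 := h6 2
  have h63 := h6 3
  have h64 := h6 4
  have h65 := h6 5
  simp [leeVec, ht.swap_left, ht.swap_right, ht.self_left, ht.self_right]
    at h60 h61 h62 h63 h64 h65
  rw [sigTrace_expand ht]
  linear_combination 8 * (t 0 2 3 * h60 + t 1 2 3 * h61 + t 0 1 2 * h62 + t 0 1 3 * h63 +
    t 0 1 4 * h64 + t 0 1 5 * h65)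

/-- The eight linear forms come from two 4×4 Hadamard matrices, so their squares add up to four
times the sum of squares of the components with one index in each line. The six remaining squares,
together with `h6`, account for all other components. -/
theorem IsSkew.eq_zero_of_squares (ht : IsSkew t) (h6 : ∀ k, leeVec t k = 0)
    (h : (t 0 2 4 - t 0 3 5 - t 1 2 5 - t 1 3 4) ^ 2 + (t 0 2 5 + t 0 3 4 + t 1 2 4 - t 1 3 5) ^ 2
      + (t 0 2 4 + t 0 3 5 + t 1 2 5 - t 1 3 4) ^ 2 + (t 0 3 4 + t 1 2 4 + t 1 3 5 - t 0 2 5) ^ 2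
      + (t 0 2 4 + t 0 3 5 - t 1 2 5 + t 1 3 4) ^ 2 + (t 0 2 5 - t 0 3 4 + t 1 2 4 + t 1 3 5) ^ 2
      + (t 0 2 4 - t 0 3 5 + t 1 2 5 + t 1 3 4) ^ 2 + (t 0 2 5 + t 0 3 4 - t 1 2 4 + t 1 3 5) ^ 2
      + 8 * (t 0 1 2 ^ 2 + t 0 1 3 ^ 2 + t 0 1 4 ^ 2 + t 0 1 5 ^ 2 + t 0 2 3 ^ 2 + t 1 2 3 ^ 2) ≤ 0)
    (i j k : Fin 6) : t i j k = 0 := by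
  have h60 := h6 0
  have h61 := h6 1
  have h62 := h6 2
  have h63 := h6 3
  have h64 := h6 4
  have h65 := h6 5
  simp [leeVec, ht.swap_left, ht.swap_right, ht.self_left, ht.self_right]
    at h60 h61 h62 h63 h64 h65
  have z : ∀ x : ℝ, x ^ 2 ≤ 0 → x = 0 := fun x hx => by
    simpa using le_antisymm hx (sq_nonneg x)
  have s := fun i j k => sq_nonneg (t i j k)
  obtain ⟨b1, b2, b3, b4, b5, b6, b7, b8, c1, c2, c3, c4, c5, c6⟩ :
      t 0 2 4 = 0 ∧ t 0 2 5 = 0 ∧ t 0 3 4 = 0 ∧ t 0 3 5 = 0 ∧ t 1 2 4 = 0 ∧ t 1 2 5 = 0 ∧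
      t 1 3 4 = 0 ∧ t 1 3 5 = 0 ∧ t 0 1 2 = 0 ∧ t 0 1 3 = 0 ∧ t 0 1 4 = 0 ∧ t 0 1 5 = 0 ∧
      t 0 2 3 = 0 ∧ t 1 2 3 = 0 := by
    refine ⟨?_, ?_, ?_, ?_, ?_, ?_, ?_, ?_, ?_, ?_, ?_, ?_, ?_, ?_⟩ <;> refine z _ ?_ <;>
    linarith only [h, s 0 2 4, s 0 2 5, s 0 3 4, s 0 3 5, s 1 2 4, s 1 2 5, s 1 3 4, s 1 3 5,
      s 0 1 2, s 0 1 3, s 0 1 4, s 0 1 5, s 0 2 3, s 1 2 3]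
  rw [c5, zero_add] at h60
  rw [c6, zero_add] at h61
  rw [c1, zero_add] at h62
  rw [c2, zero_add] at h63
  rw [c3, zero_add] at h64
  rw [c4, zero_add] at h65
  refine ht.eq_zero (fun i j k hij hjk => ?_) i j k
  fin_cases i <;> fin_cases j <;> first | exact absurd hij (by decide) | skip
  all_goals fin_cases k <;> first | exact absurd hjk (by decide) | skip
  all_goals assumption

/-- For a diagonal stabilizer, either the form vanishes or the stabilizer is special unitary and
singular. -/
theorem IsStabilizer.diagonal (ht : IsSkew t) (h6 : ∀ k, leeVec t k = 0) (htr : sigTrace t = 0)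
    (ha : IsStabilizer t a) (h02 : a 0 2 = 0) (h03 : a 0 3 = 0) (h04 : a 0 4 = 0)
    (h05 : a 0 5 = 0) (h24 : a 2 4 = 0) (h25 : a 2 5 = 0) :
    (∀ i j k, t i j k = 0) ∨ (a 0 1 + a 2 3 + a 4 5 = 0 ∧ (a 0 1 = 0 ∨ a 2 3 = 0 ∨ a 4 5 = 0)) := by
  obtain ⟨e1, e2, e3, e4, e5, e6⟩ := ha.entries
  have d0 := ha.deriv 0 2 4
  have d1 := ha.deriv 0 2 5
  have d2 := ha.deriv 0 3 4
  have d3 := ha.deriv 0 3 5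
  have d4 := ha.deriv 1 2 4
  have d5 := ha.deriv 1 2 5
  have d6 := ha.deriv 1 3 4
  have d7 := ha.deriv 1 3 5
  have f0 := ha.deriv 0 1 2
  have f1 := ha.deriv 0 1 3
  have f2 := ha.deriv 0 1 4
  have f3 := ha.deriv 0 1 5
  have f4 := ha.deriv 0 2 3
  have f5 := ha.deriv 1 2 3
  have tr := sigTrace_of_leeVec ht h6
  rw [htr] at tr
  simp [Fin.sum_univ_six, ht.swap_left, ht.swap_right, ht.self_left, ht.self_right,
      ha.self, ha.swap, e1, e2, e3, e4, e5, e6, h02, h03, h04, h05, h24, h25]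
    at d0 d1 d2 d3 d4 d5 d6 d7 f0 f1 f2 f3 f4 f5
  -- Weights of the diagonal matrix: the sum of the three entries on the (3,0)-part, the sum with
  -- one sign changed on a part with that line conjugated, a single entry on a component containing
  -- a full line. When the sum is zero, changing one sign gives -2 times that entry.
  by_cases hs : a 0 1 + a 2 3 + a 4 5 = 0
  · by_cases hp : a 0 1 = 0 ∨ a 2 3 = 0 ∨ a 4 5 = 0
    · exact Or.inr ⟨hs, hp⟩
    push Not at hp
    obtain ⟨p0, p2, p4⟩ := hp
    -- All weights except that of the (3,0)-part are nonzero; the trace identity then kills this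
    -- part too.
    left
    have hq : ∀ {c x : ℝ}, c ≠ 0 → c * x = 0 → x = 0 := fun hc h => (mul_eq_zero.1 h).resolve_left hc
    have q1 : t 0 2 4 + t 0 3 5 + t 1 2 5 - t 1 3 4 = 0 := hq p4
      (by linear_combination (d2 + d4 + d7 - d1) / 2 + hs * (t 0 2 4 + t 0 3 5 + t 1 2 5 - t 1 3 4) / 2)
    have q2 : t 0 3 4 + t 1 2 4 + t 1 3 5 - t 0 2 5 = 0 := hq p4
      (by linear_combination -(d0 + d3 + d5 - d6) / 2 + hs * (t 0 3 4 + t 1 2 4 + t 1 3 5 - t 0 2 5) / 2)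
    have r1 : t 0 2 4 + t 0 3 5 - t 1 2 5 + t 1 3 4 = 0 := hq p2
      (by linear_combination (d1 - d2 + d4 + d7) / 2 + hs * (t 0 2 4 + t 0 3 5 - t 1 2 5 + t 1 3 4) / 2)
    have r2 : t 0 2 5 - t 0 3 4 + t 1 2 4 + t 1 3 5 = 0 := hq p2
      (by linear_combination -(d0 + d3 - d5 + d6) / 2 + hs * (t 0 2 5 - t 0 3 4 + t 1 2 4 + t 1 3 5) / 2)
    have s1 : t 0 2 4 - t 0 3 5 + t 1 2 5 + t 1 3 4 = 0 := hq p0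
      (by linear_combination (d1 + d2 - d4 + d7) / 2 + hs * (t 0 2 4 - t 0 3 5 + t 1 2 5 + t 1 3 4) / 2)
    have s2 : t 0 2 5 + t 0 3 4 - t 1 2 4 + t 1 3 5 = 0 := hq p0
      (by linear_combination -(d0 - d3 + d5 + d6) / 2 + hs * (t 0 2 5 + t 0 3 4 - t 1 2 4 + t 1 3 5) / 2)
    refine ht.eq_zero_of_squares h6 ?_
    rw [q1, q2, r1, r2, s1, s2, f0.resolve_left p2, f1.resolve_left p2, f2.resolve_left p4,
      f3.resolve_left p4, f4.resolve_left p0, f5.resolve_left p0] at tr ⊢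
    linarith only [tr]
  -- The (3,0)-part has nonzero weight and vanishes, so zero trace says that a sum of squares is
  -- zero.
  · left
    have p2 := (mul_eq_zero.1 (show (a 0 1 + a 2 3 + a 4 5) *
      (t 0 2 5 + t 0 3 4 + t 1 2 4 - t 1 3 5) = 0 by
        linear_combination d0 - d3 - d5 - d6)).resolve_left hs
    have p1 := (mul_eq_zero.1 (show (a 0 1 + a 2 3 + a 4 5) *
      (t 0 2 4 - t 0 3 5 - t 1 2 5 - t 1 3 4) = 0 by
        linear_combination -d1 - d2 - d4 + d7)).resolve_left hs
    rw [p1, p2] at tr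
    refine ht.eq_zero_of_squares h6 ?_
    rw [p1, p2]
    linarith only [tr]

/-- `σ_T` is a 4-form, so it vanishes if its components with increasing indices do. -/
theorem sig_eq_zero (ht : IsSkew t)
    (h : ∀ i j k l, i < j → j < k → k < l → sig t i j k l = 0) (i j k l : Fin 6) :
    sig t i j k l = 0 := by
  have s1 : ∀ i j k l, sig t i j k l = -sig t j i k l := fun i j k l => by
    rw [sig, sig, ← Finset.sum_neg_distrib]
    refine Finset.sum_congr rfl fun m _ => ?_
    rw [(ht j i m).1, (ht i k m).1, (ht k j m).1]
    ring
  have s2 : ∀ i j k l, sig t i j k l = -sig t i k j l := fun i j k l => by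
    rw [sig, sig, ← Finset.sum_neg_distrib]
    refine Finset.sum_congr rfl fun m _ => ?_
    rw [(ht i k m).1, (ht k j m).1, (ht j i m).1]
    ring
  have s3 : ∀ i j k l, sig t i j k l = -sig t i j l k := fun i j k l => by
    rw [sig, sig, ← Finset.sum_neg_distrib]
    refine Finset.sum_congr rfl fun m _ => ?_
    rw [(ht l k m).1, (ht l i m).1, (ht k i m).1]
    ring
  have z : ∀ {x : ℝ}, x = -x → x = 0 := fun hx => by linarith
  have n : ∀ {x y : ℝ}, x = -y → y = 0 → x = 0 := fun h1 h2 => by linarith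
  -- remove the order assumptions one at a time, inserting the free index into the sorted ones
  have h3 : ∀ i j k l, i < j → j < k → sig t i j k l = 0 := fun i j k l hij hjk => by
    rcases lt_trichotomy k l with hkl | rfl | hlk
    · exact h i j k l hij hjk hkl
    · exact z (s3 _ _ _ _)
    refine n (s3 _ _ _ _) ?_
    rcases lt_trichotomy j l with hjl | rfl | hlj
    · exact h i j l k hij hjl hlk
    · exact z (s2 _ _ _ _)
    refine n (s2 _ _ _ _) ?_
    rcases lt_trichotomy i l with hil | rfl | hli
    · exact h i l j k hil hlj hjk
    · exact z (s1 _ _ _ _)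
    · exact n (s1 _ _ _ _) (h l i j k hli hij hjk)
  have h2 : ∀ i j k l, i < j → sig t i j k l = 0 := fun i j k l hij => by
    rcases lt_trichotomy j k with hjk | rfl | hkj
    · exact h3 i j k l hij hjk
    · exact z (s2 _ _ _ _)
    refine n (s2 _ _ _ _) ?_
    rcases lt_trichotomy i k with hik | rfl | hki
    · exact h3 i k j l hik hkj
    · exact z (s1 _ _ _ _)
    · exact n (s1 _ _ _ _) (h3 k i j l hki hij)
  rcases lt_trichotomy i j with hij | rfl | hji
  · exact h2 i j k l hij
  · exact z (s1 _ _ _ _)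
  · exact n (s1 _ _ _ _) (h2 j i k l hji)

/-- The normal form of a 3-form with `T₆ = 0` that is annihilated by `diag(iα, -iα, 0)`, `α ≠ 0`. -/
structure IsReduced (t : Fin 6 → Fin 6 → Fin 6 → ℝ) : Prop where
  z012 : t 0 1 2 = 0
  z013 : t 0 1 3 = 0
  z023 : t 0 2 3 = 0
  z123 : t 1 2 3 = 0
  z045 : t 0 4 5 = 0
  z145 : t 1 4 5 = 0
  z245 : t 2 4 5 = 0
  z345 : t 3 4 5 = 0
  e124 : t 1 2 4 = t 0 3 4
  e125 : t 1 2 5 = t 0 3 5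
  e134 : t 1 3 4 = -t 0 2 4
  e135 : t 1 3 5 = -t 0 2 5
  e234 : t 2 3 4 = -t 0 1 4
  e235 : t 2 3 5 = -t 0 1 5
  trace : 3 * ((t 0 2 4 - t 0 3 5) ^ 2 + (t 0 3 4 + t 0 2 5) ^ 2) =
    (t 0 2 4 + t 0 3 5) ^ 2 + (t 0 3 4 - t 0 2 5) ^ 2 + 2 * (t 0 1 4 ^ 2 + t 0 1 5 ^ 2)

/-- Only components of weight zero survive: the (3,0)-part, the part with the third line conjugated,
and the forms e₀₁ - e₂₃ wedged with the third line. The field `trace` is the trace identity divided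
by 4. -/
theorem IsStabilizer.isReduced (ht : IsSkew t) (h6 : ∀ k, leeVec t k = 0) (htr : sigTrace t = 0)
    (ha : IsStabilizer t a) (h02 : a 0 2 = 0) (h03 : a 0 3 = 0) (h04 : a 0 4 = 0)
    (h05 : a 0 5 = 0) (h24 : a 2 4 = 0) (h25 : a 2 5 = 0) (h45 : a 4 5 = 0)
    (h23 : a 2 3 = -a 0 1) (h01 : a 0 1 ≠ 0) : IsReduced t := by
  obtain ⟨e1, e2, e3, e4, e5, e6⟩ := ha.entries
  have d0 := ha.deriv 0 2 4
  have d1 := ha.deriv 0 2 5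
  have d2 := ha.deriv 0 3 4
  have d3 := ha.deriv 0 3 5
  have f0 := ha.deriv 0 1 2
  have f1 := ha.deriv 0 1 3
  have f4 := ha.deriv 0 2 3
  have f5 := ha.deriv 1 2 3
  have h60 := h6 0
  have h61 := h6 1
  have h62 := h6 2
  have h63 := h6 3
  have h64 := h6 4
  have h65 := h6 5
  have tr := sigTrace_of_leeVec ht h6
  rw [htr] at tr
  simp [leeVec, ht.swap_left, ht.swap_right, ht.self_left, ht.self_right]
    at h60 h61 h62 h63 h64 h65
  simp [Fin.sum_univ_six, ht.swap_left, ht.swap_right, ht.self_left, ht.self_right, ha.self,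
      ha.swap, e1, e2, e3, e4, e5, e6, h02, h03, h04, h05, h24, h25, h23, h45, h01]
    at d0 d1 d2 d3 f0 f1 f4 f5
  rw [f5, zero_add] at h60
  rw [f4, zero_add] at h61
  rw [f1, zero_add] at h62
  rw [f0, zero_add] at h63
  have g0 : t 1 2 4 = t 0 3 4 := mul_left_cancel₀ h01 (by linarith)
  have g1 : t 1 2 5 = t 0 3 5 := mul_left_cancel₀ h01 (by linarith)
  have g2 : t 1 3 4 = -t 0 2 4 := mul_left_cancel₀ h01 (by linarith)
  have g3 : t 1 3 5 = -t 0 2 5 := mul_left_cancel₀ h01 (by linarith)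
  have g4 : t 2 3 4 = -t 0 1 4 := by linarith
  have g5 : t 2 3 5 = -t 0 1 5 := by linarith
  rw [f0, f1, f4, f5, g0, g1, g2, g3] at tr
  exact ⟨f1, f0, f5, f4, h60, h61, h62, h63, g0, g1, g2, g3, g4, g5, by linarith⟩

theorem IsReduced.sig_eq_zero (ht : IsSkew t) (h : IsReduced t)
    (hD : t 0 1 4 ^ 2 + t 0 1 5 ^ 2 = (t 0 2 4 + t 0 3 5) ^ 2 + (t 0 3 4 - t 0 2 5) ^ 2)
    (i j k l : Fin 6) : sig t i j k l = 0 := by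
  have tr := h.trace
  -- Under `hD`, `h.trace` says that the (3,0)-part and the conjugated part have equal norm, which
  -- is `H1`; `H2` then rewrites `hD`. All components of σ follow linearly from these two relations.
  have H1 : t 0 2 4 * t 0 3 5 = t 0 2 5 * t 0 3 4 := by linarith
  have H2 : t 0 1 4 ^ 2 + t 0 1 5 ^ 2 =
    t 0 2 4 ^ 2 + t 0 2 5 ^ 2 + t 0 3 4 ^ 2 + t 0 3 5 ^ 2 := by linarith
  refine AlmostHermitian.sig_eq_zero ht (fun i j k l hij hjk hkl => ?_) i j k l
  fin_cases i <;> fin_cases j <;> first | exact absurd hij (by decide) | skip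
  all_goals fin_cases k <;> first | exact absurd hjk (by decide) | skip
  all_goals fin_cases l <;> first | exact absurd hkl (by decide) | skip
  all_goals
    simp [sig, Fin.sum_univ_six, ht.swap_left, ht.swap_right, ht.self_left, ht.self_right, h.z013,
      h.z012, h.z123, h.z023, h.e124, h.e125, h.e134, h.e135, h.e234, h.e235, h.z045, h.z145, h.z245, h.z345]
  all_goals try linarith

theorem IsReduced.stabilizer (ht : IsSkew t) (h : IsReduced t)
    (hD : ¬ t 0 1 4 ^ 2 + t 0 1 5 ^ 2 = (t 0 2 4 + t 0 3 5) ^ 2 + (t 0 3 4 - t 0 2 5) ^ 2)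
    (ha : IsStabilizer t a) (j : Fin 6) : a 4 j = 0 := by
  have tr := h.trace
  obtain ⟨e1, e2, e3, e4, e5, e6⟩ := ha.entries
  have d0 := ha.deriv 0 1 2
  have d4 := ha.deriv 4 5 0
  have d5 := ha.deriv 4 5 1
  have d7 := ha.deriv 4 5 3
  have k0 := ha.deriv 0 1 4
  have k1 := ha.deriv 0 1 5
  have k2 := ha.deriv 0 2 4
  have k3 := ha.deriv 0 3 4
  have k4 := ha.deriv 0 2 5
  have k5 := ha.deriv 0 3 5
  have k6 := ha.deriv 1 2 4
  have k7 := ha.deriv 1 3 4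
  have k8 := ha.deriv 1 2 5
  have k9 := ha.deriv 1 3 5
  simp [Fin.sum_univ_six, ht.swap_left, ht.swap_right, ht.self_left, ht.self_right, ha.self,
    ha.swap, e1, e2, e3, e4, e5, e6, h.z013, h.z012, h.z123, h.z023, h.e124, h.e125, h.e134, h.e135, h.e234, h.e235, h.z045, h.z145, h.z245, h.z345]
    at d0 d4 d5 d7 k0 k1 k2 k3 k4 k5 k6 k7 k8 k9
  have hD' := sub_ne_zero.2 hD
  -- The equations `d0`, `d4`, `d5`, `d7` are linear in `a 0 4`, `a 0 5`, `a 2 4`, `a 2 5`; each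
  -- combination isolates one unknown, with the difference in `hD` as coefficient.
  have w0 : a 0 4 = 0 := (mul_eq_zero.1 (show _ * a 0 4 = 0 by
    linear_combination t 0 1 4 * d4 + t 0 1 5 * d5 - (t 0 3 4 - t 0 2 5) * d0
      - (t 0 2 4 + t 0 3 5) * d7)).resolve_left hD'
  have w1 : a 0 5 = 0 := (mul_eq_zero.1 (show _ * a 0 5 = 0 by
    linear_combination t 0 1 5 * d4 - t 0 1 4 * d5 - (t 0 2 4 + t 0 3 5) * d0
      + (t 0 3 4 - t 0 2 5) * d7)).resolve_left hD'
  have w2 : a 2 4 = 0 := (mul_eq_zero.1 (show _ * a 2 4 = 0 by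
    linear_combination t 0 1 4 * d0 - t 0 1 5 * d7 - (t 0 3 4 - t 0 2 5) * d4
      + (t 0 2 4 + t 0 3 5) * d5)).resolve_left hD'
  have w3 : a 2 5 = 0 := (mul_eq_zero.1 (show _ * a 2 5 = 0 by
    linear_combination t 0 1 5 * d0 + t 0 1 4 * d7 - (t 0 2 4 + t 0 3 5) * d4
      - (t 0 3 4 - t 0 2 5) * d5)).resolve_left hD'
  -- If `a 4 5 ≠ 0`, then `t 0 1 4` and `t 0 1 5` vanish, and what remains is a (3,0)-part of weight
  -- `d + c` and a conjugated part of weight `d - c`. By `hD` the latter is nonzero, so `d = c`;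
  -- then the former vanishes, against `h.trace`.
  have w4 : a 4 5 = 0 := by
    by_contra hc
    have x1 : t 0 1 4 = 0 := by simpa [hc] using k1
    have x2 : t 0 1 5 = 0 := by simpa [hc] using k0
    rw [x1, x2] at tr hD
    set d := a 0 1 + a 2 3 with hd
    set c := a 4 5
    have m1 : d * t 0 2 4 = c * t 0 3 5 := by rw [hd]; linarith
    have m2 : d * t 0 3 5 = c * t 0 2 4 := by rw [hd]; linarith
    have m3 : d * t 0 3 4 = -c * t 0 2 5 := by rw [hd]; linarith
    have m4 : d * t 0 2 5 = -c * t 0 3 4 := by rw [hd]; linarith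
    have y : (d - c) * ((t 0 2 4 + t 0 3 5) ^ 2 + (t 0 3 4 - t 0 2 5) ^ 2) = 0 := by
      linear_combination (t 0 2 4 + t 0 3 5) * (m1 + m2) + (t 0 3 4 - t 0 2 5) * (m3 - m4)
    have hy : d - c = 0 := (mul_eq_zero.1 y).resolve_right fun h => hD (by rw [h]; norm_num)
    have n1 : (d + c) * ((t 0 2 4 - t 0 3 5) ^ 2 + (t 0 3 4 + t 0 2 5) ^ 2) = 0 := by
      linear_combination (t 0 2 4 - t 0 3 5) * (m1 - m2) + (t 0 3 4 + t 0 2 5) * (m3 + m4)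
    have n2 : (t 0 2 4 - t 0 3 5) ^ 2 + (t 0 3 4 + t 0 2 5) ^ 2 = 0 :=
      (mul_eq_zero.1 n1).resolve_left fun h => hc (by linarith)
    exact hD (by linarith)
  fin_cases j <;> simp [ha.self, ha.swap, e4, e6, w0, w1, w2, w3, w4]

end Components

/-! ### Vanishing of σ on a hermitian vector space from the vanishing of its trace. -/

section Pointwise

variable {V : Type*} [NormedAddCommGroup V] [InnerProductSpace ℝ V] {J : V →ₗ[ℝ] V}
  {τ : V →ₗ[ℝ] V →ₗ[ℝ] V} {A : V →ₗ[ℝ] V} {e : Fin 6 → V}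

/-- `(x, y, z) ↦ g(τ(x, y), z)` is a 3-form. -/
structure IsSkewTorsion (τ : V →ₗ[ℝ] V →ₗ[ℝ] V) : Prop where
  antisymm : ∀ x y, τ x y = -τ y x
  skew : ∀ x y z, inner ℝ (τ x y) z = -inner ℝ (τ x z) y

/-- `A` is a skew-hermitian endomorphism annihilating `τ`. -/
structure IsInfinitesimalAut (J : V →ₗ[ℝ] V) (τ : V →ₗ[ℝ] V →ₗ[ℝ] V) (A : V →ₗ[ℝ] V) : Prop where
  skew : ∀ x y, inner ℝ (A x) y = -inner ℝ x (A y)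
  comm : ∀ x, A (J x) = J (A x)
  deriv : ∀ x y, A (τ x y) = τ (A x) y + τ x (A y)

/-- Components of a torsion tensor in a frame. -/
def torsionComp (τ : V →ₗ[ℝ] V →ₗ[ℝ] V) (e : Fin 6 → V) (i j k : Fin 6) : ℝ :=
  inner ℝ (τ (e i) (e j)) (e k)

/-- The 4-form `σ` of a torsion tensor. -/
def sigmaTensor (τ : V →ₗ[ℝ] V →ₗ[ℝ] V) (x y z w : V) : ℝ :=
  inner ℝ (τ x y) (τ z w) + inner ℝ (τ y z) (τ x w) + inner ℝ (τ z x) (τ y w)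

/-- Matches σ with the torsion side of the Bianchi identity. -/
theorem IsSkewTorsion.sigmaTensor_eq (hτ : IsSkewTorsion τ) (x y z w : V) :
    sigmaTensor τ x y z w = inner ℝ (τ (τ x y) z + τ (τ y z) x + τ (τ z x) y) w := by
  have h : ∀ x y z w, inner ℝ (τ (τ x y) z) w = inner ℝ (τ x y) (τ z w) := fun x y z w => by
    rw [hτ.antisymm, inner_neg_left, hτ.skew, neg_neg, real_inner_comm]
  rw [inner_add_left, inner_add_left, h, h, h, sigmaTensor]

theorem IsSkewTorsion.isSkew (hτ : IsSkewTorsion τ) (e : Fin 6 → V) : IsSkew (torsionComp τ e) :=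
  fun i j k => ⟨by rw [torsionComp, hτ.antisymm, inner_neg_left, torsionComp],
    hτ.skew _ _ _⟩

/-- Rotating the three complex lines of a unitary frame. -/
theorem IsUnitaryFrame.rotate (he : IsUnitaryFrame J e) :
    IsUnitaryFrame J (e ∘ ![2, 3, 4, 5, 0, 1]) where
  orthonormal := he.orthonormal.comp _ (by decide)
  kahler i j := by
    simp only [Function.comp_apply, he.kahler]
    fin_cases i <;> fin_cases j <;> rfl

section Frame
variable [FiniteDimensional ℝ V]

/-- A unitary frame as an orthonormal basis. -/
theorem IsUnitaryFrame.exists_basis (hV : Module.finrank ℝ V = 6) (he : IsUnitaryFrame J e) :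
    ∃ b : OrthonormalBasis (Fin 6) ℝ V, ⇑b = e := by
  have hs := he.orthonormal.linearIndependent.span_eq_top_of_card_eq_finrank' (by simp [hV])
  exact ⟨OrthonormalBasis.mk he.orthonormal hs.ge, OrthonormalBasis.coe_mk _ _⟩

theorem IsUnitaryFrame.sum_inner (hV : Module.finrank ℝ V = 6) (he : IsUnitaryFrame J e) (x : V) :
    ∑ m, inner ℝ x (e m) • e m = x := by
  obtain ⟨b, rfl⟩ := he.exists_basis hV
  simpa only [real_inner_comm] using b.sum_repr' x

theorem IsUnitaryFrame.sum_inner_mul (hV : Module.finrank ℝ V = 6) (he : IsUnitaryFrame J e) (x y : V) :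
    ∑ m, inner ℝ x (e m) * inner ℝ y (e m) = (inner ℝ x y : ℝ) := by
  obtain ⟨b, rfl⟩ := he.exists_basis hV
  simpa only [real_inner_comm] using b.sum_inner_mul_inner x y

theorem IsUnitaryFrame.sigmaTensor_apply (hV : Module.finrank ℝ V = 6) (he : IsUnitaryFrame J e) (i j k l : Fin 6) :
    sigmaTensor τ (e i) (e j) (e k) (e l) = sig (torsionComp τ e) i j k l := by
  simp only [sigmaTensor, sig, torsionComp, Finset.sum_add_distrib, he.sum_inner_mul hV]

theorem IsUnitaryFrame.sigmaTensor_eq_zero (hV : Module.finrank ℝ V = 6) (he : IsUnitaryFrame J e) (hτ : IsSkewTorsion τ)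
    (h : ∀ i j k l, sig (torsionComp τ e) i j k l = 0) (x y z w : V) :
    sigmaTensor τ x y z w = 0 := by
  have h0 : ∀ i j k, τ (τ (e i) (e j)) (e k) + τ (τ (e j) (e k)) (e i) + τ (τ (e k) (e i)) (e j)
      = 0 := fun i j k => by
    rw [← he.sum_inner hV (_ + _)]
    refine Finset.sum_eq_zero fun l _ => ?_
    rw [← hτ.sigmaTensor_eq, he.sigmaTensor_apply hV, h, zero_smul]
  obtain ⟨b, rfl⟩ := he.exists_basis hV
  let B : V →ₗ[ℝ] V →ₗ[ℝ] V →ₗ[ℝ] V := LinearMap.mk₂ ℝ (fun x y => τ (τ x y) + τ.flip x ∘ₗ τ y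
      + (τ.flip y) ∘ₗ τ.flip x) (by intros; ext; simp; abel) (by intros; ext; simp)
      (by intros; ext; simp; abel) (by intros; ext; simp)
  have hB : B = 0 := b.toBasis.ext fun i => b.toBasis.ext fun j => b.toBasis.ext fun k => by
    simpa [B] using h0 i j k
  have := congrArg (fun C : V →ₗ[ℝ] V →ₗ[ℝ] V →ₗ[ℝ] V => C x y z) hB
  simp only [B, LinearMap.mk₂_apply, LinearMap.add_apply, LinearMap.comp_apply,
    LinearMap.flip_apply, LinearMap.zero_apply] at this
  rw [hτ.sigmaTensor_eq, this, inner_zero_left]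

theorem IsUnitaryFrame.isStabilizer (hV : Module.finrank ℝ V = 6) (he : IsUnitaryFrame J e)
    (hA : IsInfinitesimalAut J τ A) :
    IsStabilizer (torsionComp τ e) fun i j => inner ℝ (A (e i)) (e j) where
  skew i j := by rw [hA.skew, real_inner_comm]
  comm i j := by
    have h1 : J (e i) = ∑ m, Om i m • e m := by
      rw [← he.sum_inner hV (J (e i))]; simp only [he.kahler]
    have h2 : inner ℝ (A (J (e i))) (e j) = inner ℝ (J (A (e i))) (e j) := by rw [hA.comm]
    rw [h1, ← he.sum_inner hV (A (e i))] at h2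
    simpa [_root_.sum_inner, inner_smul_left, he.kahler] using h2
  deriv i j k := by
    have h := congrArg (fun x => inner ℝ x (e k)) (hA.deriv (e i) (e j))
    simp only [inner_add_left] at h
    rw [hA.skew, ← he.sum_inner_mul hV] at h
    nth_rewrite 1 [← he.sum_inner hV (A (e i))] at h
    nth_rewrite 1 [← he.sum_inner hV (A (e j))] at h
    simp only [map_sum, map_smul, LinearMap.sum_apply, LinearMap.smul_apply, _root_.sum_inner,
      inner_smul_left, RCLike.conj_to_real] at h
    simp only [Finset.sum_add_distrib, torsionComp]
    simp only [mul_comm (inner ℝ (A (e k)) _)]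
    linarith

theorem IsUnitaryFrame.apply_J (hV : Module.finrank ℝ V = 6) (he : IsUnitaryFrame J e) (i : Fin 6) :
    J (e i) = ∑ m, Om i m • e m := by
  rw [← he.sum_inner hV (J (e i))]; simp only [he.kahler]

/-- The hypothesis `hB` is the Bianchi identity with `A`, `B`, `C` in the role of R(x,y), R(y,z),
R(z,x). By skewness, a vector killed by all automorphisms lies in the kernel of σ, and so does its
image under J. In a frame containing both, the single component left is the trace. -/
theorem sigmaTensor_eq_zero_of_kernel (hV : Module.finrank ℝ V = 6) (hJ : IsOrthogonalComplex J)
    (hτ : IsSkewTorsion τ)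
    (hB : ∀ x y z, ∃ A B C, IsInfinitesimalAut J τ A ∧ IsInfinitesimalAut J τ B ∧
      IsInfinitesimalAut J τ C ∧ A z + B x + C y = τ (τ x y) z + τ (τ y z) x + τ (τ z x) y)
    (htr : ∀ e, IsUnitaryFrame J e → sigTrace (torsionComp τ e) = 0)
    {v : V} (hv : v ≠ 0) (hker : ∀ A, IsInfinitesimalAut J τ A → A v = 0) (x y z w : V) :
    sigmaTensor τ x y z w = 0 := by
  have hv' : ‖‖v‖⁻¹ • v‖ = 1 := by
    rw [norm_smul, norm_inv, norm_norm, inv_mul_cancel₀ (norm_ne_zero_iff.2 hv)]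
  -- With `H = 0` every vector is an eigenvector: this completes v/‖v‖ to a unitary frame.
  obtain ⟨e, he, h4, -, -, h5, -⟩ := exists_unitaryFrame hV hJ (H := 0) (fun _ _ => by simp)
    (fun _ => by simp) hv' ⟨0, by simp⟩
  have k4 : ∀ A, IsInfinitesimalAut J τ A → A (e 4) = 0 := fun A hA => by
    rw [h4, map_smul, hker A hA, smul_zero]
  have k5 : ∀ A, IsInfinitesimalAut J τ A → A (e 5) = 0 := fun A hA => by
    rw [h5, hA.comm, k4 A hA, map_zero]
  have key : ∀ u, (∀ A, IsInfinitesimalAut J τ A → A u = 0) → ∀ x y z, sigmaTensor τ x y z u = 0 := by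
    intro u hu x y z
    obtain ⟨A, B, C, hA, hB, hC, h⟩ := hB x y z
    rw [hτ.sigmaTensor_eq, ← h, inner_add_left, inner_add_left, hA.skew, hB.skew, hC.skew, hu A hA,
      hu B hB, hu C hC]
    simp
  have s4 : ∀ i j k, sig (torsionComp τ e) i j k 4 = 0 := fun i j k => by
    rw [← he.sigmaTensor_apply hV, key _ k4]
  have s5 : ∀ i j k, sig (torsionComp τ e) i j k 5 = 0 := fun i j k => by
    rw [← he.sigmaTensor_apply hV, key _ k5]
  refine he.sigmaTensor_eq_zero hV hτ (sig_eq_zero (hτ.isSkew e) ?_) x y z w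
  intro i j k l hij hjk hkl
  by_cases h4 : l = 4
  · rw [h4, s4]
  by_cases h5 : l = 5
  · rw [h5, s5]
  obtain rfl : i = 0 := by omega
  obtain rfl : j = 1 := by omega
  obtain rfl : k = 2 := by omega
  obtain rfl : l = 3 := by omega
  have := htr e he
  rwa [sigTrace, s5, s5, add_zero, add_zero] at this

/-- A torsion tensor whose `σ` is determined by its infinitesimal automorphisms through the first
Bianchi identity has `σ = 0` as soon as the trace of `σ` with the Kähler form squared vanishes. -/
theorem sigmaTensor_eq_zero_of_sigTrace (hV : Module.finrank ℝ V = 6) (hJ : IsOrthogonalComplex J)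
    (hτ : IsSkewTorsion τ)
    (hB : ∀ x y z, ∃ A B C, IsInfinitesimalAut J τ A ∧ IsInfinitesimalAut J τ B ∧
      IsInfinitesimalAut J τ C ∧ A z + B x + C y = τ (τ x y) z + τ (τ y z) x + τ (τ z x) y)
    (htr : ∀ e, IsUnitaryFrame J e → sigTrace (torsionComp τ e) = 0) (x y z w : V) :
    sigmaTensor τ x y z w = 0 := by
  have hK : ∀ v : V, v ≠ 0 → (∀ A, IsInfinitesimalAut J τ A → A v = 0) →
      ∀ x y z w, sigmaTensor τ x y z w = 0 := fun v hv hker =>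
    sigmaTensor_eq_zero_of_kernel hV hJ hτ hB htr hv hker
  by_contra hne
  have hK' : ∀ v : V, (∀ A, IsInfinitesimalAut J τ A → A v = 0) → v = 0 := fun v hv => by
    by_contra h0; exact hne (hK v h0 hv x y z w)
  -- The trace of T with Ω is killed by every automorphism, and the common kernel is now zero.
  have hlee : ∀ e, IsUnitaryFrame J e → ∀ k, leeVec (torsionComp τ e) k = 0 := by
    intro e he
    have h0 : ∑ m, leeVec (torsionComp τ e) m • e m = 0 := hK' _ fun A hA => by
      rw [← he.sum_inner hV (A _)]
      refine Finset.sum_eq_zero fun j _ => ?_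
      have := (he.isStabilizer hV hA).sum_leeVec (hτ.isSkew e) j
      simp only [map_sum, map_smul, _root_.sum_inner, inner_smul_left, RCLike.conj_to_real]
      rw [this, zero_smul]
    exact Fintype.linearIndependent_iff.1 he.orthonormal.linearIndependent _ h0
  have hsig : ∀ e, IsUnitaryFrame J e → (∀ i j k l, sig (torsionComp τ e) i j k l = 0) → False :=
    fun e he h => hne (he.sigmaTensor_eq_zero hV hτ h x y z w)
  obtain ⟨A, hA, hA0⟩ : ∃ A, IsInfinitesimalAut J τ A ∧ A ≠ 0 := by
    by_contra! h
    have : Nontrivial V := Module.nontrivial_of_finrank_pos (R := ℝ) (by omega)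
    obtain ⟨v, hv⟩ := exists_ne (0 : V)
    exact hv (hK' v fun A hA => by rw [h A hA, LinearMap.zero_apply])
  -- The case A = diag(iα, -iα, 0), stated for any frame because the zero eigenvalue may have to be
  -- moved to the last line.
  have final : ∀ e, IsUnitaryFrame J e → (∀ a : Fin 6 → Fin 6 → ℝ,
      (a = fun i j => inner ℝ (A (e i)) (e j)) → a 0 2 = 0 ∧ a 0 3 = 0 ∧ a 0 4 = 0 ∧ a 0 5 = 0 ∧
      a 2 4 = 0 ∧ a 2 5 = 0 ∧ a 4 5 = 0 ∧ a 2 3 = -a 0 1 ∧ a 0 1 ≠ 0) → False := by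
    intro e he h
    obtain ⟨h02, h03, h04, h05, h24, h25, h45, h23, h01⟩ := h _ rfl
    have hred := (he.isStabilizer hV hA).isReduced (hτ.isSkew e) (hlee e he) (htr e he) h02 h03 h04
      h05 h24 h25 h45 h23 h01
    refine hsig e he (hred.sig_eq_zero (hτ.isSkew e) ?_)
    by_contra hD
    refine (he.orthonormal.ne_zero 4) (hK' _ fun B hB => ?_)
    rw [← he.sum_inner hV (B _)]
    refine Finset.sum_eq_zero fun j _ => ?_
    have := hred.stabilizer (hτ.isSkew e) hD (he.isStabilizer hV hB) j
    rw [this, zero_smul]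
  -- -JA is symmetric and commutes with J; an eigenvector of -JA for c satisfies A x = c J x.
  have hHs : (-(J ∘ₗ A)).IsSymmetric := fun x y => by
    simp only [LinearMap.neg_apply, LinearMap.comp_apply, inner_neg_left, inner_neg_right,
      hJ.inner_left]
    rw [hA.skew, hA.comm, neg_neg]
  have hHJ : ∀ x, (-(J ∘ₗ A)) (J x) = J ((-(J ∘ₗ A)) x) := fun x => by
    simp [hA.comm]
  have hVn : (⊤ : Submodule ℝ V) ≠ ⊥ := by
    have : Nontrivial V := Module.nontrivial_of_finrank_pos (R := ℝ) (by omega)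
    exact top_ne_bot
  obtain ⟨v, -, hv, hHv⟩ := exists_unit_eigenvector hHs hVn (fun _ _ => trivial)
  obtain ⟨e, he, h4, h1, h3, h5, ⟨c0, hc0⟩, ⟨c2, hc2⟩⟩ := exists_unitaryFrame hV hJ hHs hHJ hv hHv
  rw [← h4] at hHv
  obtain ⟨c4, hc4⟩ := hHv
  have hJA : ∀ x c, (-(J ∘ₗ A)) x = c • x → A x = c • J x := fun x c h => by
    rw [← map_smul, ← h]; simp [hJ.sq]
  have a0 : A (e 0) = c0 • e 1 := by rw [hJA _ _ hc0, h1]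
  have a2 : A (e 2) = c2 • e 3 := by rw [hJA _ _ hc2, h3]
  have a4 : A (e 4) = c4 • e 5 := by rw [hJA _ _ hc4, h5]
  have a1 : A (e 1) = -c0 • e 0 := by rw [h1, hA.comm, a0, map_smul, h1, hJ.sq]; simp
  have a3 : A (e 3) = -c2 • e 2 := by rw [h3, hA.comm, a2, map_smul, h3, hJ.sq]; simp
  have a5 : A (e 5) = -c4 • e 4 := by rw [h5, hA.comm, a4, map_smul, h5, hJ.sq]; simp
  have hin : ∀ i j, inner ℝ (e i) (e j) = if i = j then 1 else 0 :=
    orthonormal_iff_ite.1 he.orthonormal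
  have hA0' : ¬ (c0 = 0 ∧ c2 = 0 ∧ c4 = 0) := fun ⟨z0, z2, z4⟩ => hA0 <| LinearMap.ext fun x => by
    rw [← he.sum_inner hV x]
    simp [Fin.sum_univ_six, a0, a1, a2, a3, a4, a5, z0, z2, z4]
  have hdiag := (he.isStabilizer hV hA).diagonal (hτ.isSkew e) (hlee e he) (htr e he)
    (by simp [a0, inner_smul_left, hin]) (by simp [a0, inner_smul_left, hin])
    (by simp [a0, inner_smul_left, hin]) (by simp [a0, inner_smul_left, hin])
    (by simp [a2, inner_smul_left, hin]) (by simp [a2, inner_smul_left, hin])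
  rcases hdiag with h0 | ⟨hs, h⟩
  · exact hsig e he fun i j k l => by simp [sig, h0]
  simp only [a0, a2, a4, inner_smul_left, hin, if_true, RCLike.conj_to_real, mul_one] at hs h
  rcases h with rfl | rfl | rfl
  · refine final _ he.rotate ?_
    rintro a rfl
    simp [a0, a2, a4, inner_smul_left, hin, he.orthonormal.1]
    refine ⟨by linarith, fun h => hA0' ⟨rfl, h, by linarith⟩⟩
  · refine final _ he.rotate.rotate ?_
    rintro a rfl
    simp [a0, a2, a4, inner_smul_left, hin, he.orthonormal.1]
    refine ⟨by linarith, fun h => hA0' ⟨by linarith, rfl, h⟩⟩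
  · refine final _ he ?_
    rintro a rfl
    simp [a0, a2, a4, inner_smul_left, hin, he.orthonormal.1]
    refine ⟨by linarith, fun h => hA0' ⟨h, by linarith, rfl⟩⟩

end Frame

end Pointwise

/-! ### Transfer to tangent spaces. -/

section Manifold
variable {M : Type*} [TopologicalSpace M] [ChartedSpace R6 M] [IsManifold (𝓡 6) ∞ M]
  [RiemannianBundle (TangentSpace (𝓡 6) : M → Type)]
  [IsContMDiffRiemannianBundle (𝓡 6) ∞ R6 (TangentSpace (𝓡 6) : M → Type)]
  {X Y Z W : (p : M) → TangentSpace (𝓡 6) p}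
  {cov : CovariantDerivative (𝓡 6) R6 (TangentSpace (𝓡 6) : M → Type)}
  {J : (p : M) → TangentSpace (𝓡 6) p →L[ℝ] TangentSpace (𝓡 6) p}

instance (p : M) : FiniteDimensional ℝ (TangentSpace (𝓡 6) p) :=
  inferInstanceAs (FiniteDimensional ℝ R6)

theorem finrank_tangentSpace (p : M) : Module.finrank ℝ (TangentSpace (𝓡 6) p) = 6 :=
  finrank_euclideanSpace_fin (𝕜 := ℝ) (n := 6)

/-- The torsion at a point as a bilinear map. -/
def torsionMap (cov : CovariantDerivative (𝓡 6) R6 (TangentSpace (𝓡 6) : M → Type)) (p : M) :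
    TangentSpace (𝓡 6) p →ₗ[ℝ] TangentSpace (𝓡 6) p →ₗ[ℝ] TangentSpace (𝓡 6) p :=
  LinearMap.mk₂ ℝ (fun x y => cov.torsion p x y) (by simp) (by simp) (by simp) (by simp)

theorem IsOrthogonalAlmostComplex.isOrthogonalComplex (hJ : IsOrthogonalAlmostComplex J) (p : M) :
    IsOrthogonalComplex (J p : TangentSpace (𝓡 6) p →ₗ[ℝ] TangentSpace (𝓡 6) p) :=
  ⟨hJ.sq p, hJ.orthogonal p⟩

theorem isAdaptedFrame_iff {p : M} {e : Fin 6 → TangentSpace (𝓡 6) p} :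
    IsAdaptedFrame J p e ↔ IsUnitaryFrame (J p : TangentSpace (𝓡 6) p →ₗ[ℝ] TangentSpace (𝓡 6) p) e :=
  ⟨fun h => ⟨h.1, h.2⟩, fun h => ⟨h.1, h.2⟩⟩

theorem IsOrthogonalAlmostComplex.exists_isAdaptedFrame (hJ : IsOrthogonalAlmostComplex J) (p : M) :
    ∃ e, IsAdaptedFrame J p e := by
  have : Nontrivial (TangentSpace (𝓡 6) p) :=
    Module.nontrivial_of_finrank_pos (R := ℝ) (by rw [finrank_tangentSpace]; norm_num)
  obtain ⟨v, hv⟩ := exists_norm_eq (TangentSpace (𝓡 6) p) zero_le_one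
  obtain ⟨e, he, -⟩ := exists_unitaryFrame (finrank_tangentSpace p) (hJ.isOrthogonalComplex p)
    (H := 0) (fun _ _ => by simp) (fun _ => by simp) hv ⟨0, by simp⟩
  exact ⟨e, isAdaptedFrame_iff.2 he⟩

theorem IsCharacteristicConnection.isSkewTorsion (hc : IsCharacteristicConnection J cov) (p : M) :
    IsSkewTorsion (torsionMap cov p) :=
  ⟨fun x y => cov.torsion_antisymm x y, fun x y z => hc.skew p x y z⟩

/-- The curvature operators are infinitesimal automorphisms of `(g, J, T)`. -/
theorem IsCharacteristicConnection.exists_curv [T2Space M] (hJ : IsOrthogonalAlmostComplex J)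
    (hc : IsCharacteristicConnection J cov) (hp : HasParallelTorsion cov)
    (hX : IsSmoothField X) (hY : IsSmoothField Y) (p : M) :
    ∃ A, IsInfinitesimalAut (J p : TangentSpace (𝓡 6) p →ₗ[ℝ] TangentSpace (𝓡 6) p)
      (torsionMap cov p) A ∧ ∀ Z, IsSmoothField Z → A (Z p) = curv cov X Y Z p := by
  choose E hE hEp using fun v : TangentSpace (𝓡 6) p => exists_isSmoothField p v
  have hsk : ∀ v w, inner ℝ (curv cov X Y (E v) p) w = -inner ℝ v (curv cov X Y (E w) p) := by
    intro v w
    simpa only [hEp] using inner_curv_skew hc.smooth hc.metric hX hY (hE v) (hE w) p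
  -- Linearity in `v` comes from skewness: paired with `w`, the curvature is minus the inner product
  -- of `v` with a fixed vector. Independence of the extension, in `hA`, follows in the same way.
  let A : TangentSpace (𝓡 6) p →ₗ[ℝ] TangentSpace (𝓡 6) p :=
    { toFun := fun v => curv cov X Y (E v) p
      map_add' := fun v v' => ext_inner_right ℝ fun w => by
        simp only [inner_add_left, hsk]; ring
      map_smul' := fun c v => ext_inner_right ℝ fun w => by
        simp only [inner_smul_left, hsk, RCLike.conj_to_real, RingHom.id_apply]; ring }
  have hA : ∀ Z, IsSmoothField Z → A (Z p) = curv cov X Y Z p := fun Z hZ =>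
    ext_inner_right ℝ fun w => by
      have h := inner_curv_skew hc.smooth hc.metric hX hY hZ (hE w) p
      rw [hEp] at h
      exact (hsk _ _).trans h.symm
  refine ⟨A, ⟨hsk, fun x => ?_, fun x y => ?_⟩, hA⟩
  · have h := curv_J hc hX hY (hE x) p
    rw [← hA _ (hE x), ← hA _ ((hE x).apply_J hJ), hEp] at h
    exact h
  · have h := curv_torsion hc.smooth hc.metric hp hX hY (hE x) (hE y) p
    rw [← hA _ ((hE x).torsion hc.smooth (hE y)), ← hA _ (hE x), ← hA _ (hE y), hEp, hEp] at h
    exact h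

theorem IsCharacteristicConnection.sigmaForm_eq_zero [T2Space M]
    (hJ : IsOrthogonalAlmostComplex J) (hc : IsCharacteristicConnection J cov)
    (hp : HasParallelTorsion cov) (p : M)
    (htr : ∀ e, IsAdaptedFrame J p e → sigTrace (torsionComp (torsionMap cov p) e) = 0)
    (x y z w : TangentSpace (𝓡 6) p) : sigmaForm cov p x y z w = 0 := by
  refine sigmaTensor_eq_zero_of_sigTrace (finrank_tangentSpace p) (hJ.isOrthogonalComplex p)
    (hc.isSkewTorsion p) (fun x y z => ?_) (fun e he => htr e (isAdaptedFrame_iff.2 he)) x y z w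
  obtain ⟨X, hX, rfl⟩ := exists_isSmoothField p x
  obtain ⟨Y, hY, rfl⟩ := exists_isSmoothField p y
  obtain ⟨Z, hZ, rfl⟩ := exists_isSmoothField p z
  obtain ⟨A, hA, hA'⟩ := hc.exists_curv hJ hp hX hY p
  obtain ⟨B, hB, hB'⟩ := hc.exists_curv hJ hp hY hZ p
  obtain ⟨C, hC, hC'⟩ := hc.exists_curv hJ hp hZ hX p
  refine ⟨A, B, C, hA, hB, hC, ?_⟩
  rw [hA' _ hZ, hB' _ hX, hC' _ hY]
  exact bianchi hc.smooth hc.metric hp hX hY hZ p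

theorem IsAdaptedFrame.sigmaForm_eq_zero_iff (hc : IsCharacteristicConnection J cov) {p : M}
    {e : Fin 6 → TangentSpace (𝓡 6) p} (he : IsAdaptedFrame J p e) :
    (∀ x y z w, sigmaForm cov p x y z w = 0) ↔
      ∀ i j k l, sig (torsionComp (torsionMap cov p) e) i j k l = 0 := by
  have he' := isAdaptedFrame_iff.1 he
  refine ⟨fun h i j k l => ?_, fun h => ?_⟩
  · rw [← he'.sigmaTensor_apply (finrank_tangentSpace p)]
    exact h _ _ _ _
  · exact he'.sigmaTensor_eq_zero (finrank_tangentSpace p) (hc.isSkewTorsion p) h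

end Manifold

/-! ### The components of the intrinsic torsion and the quadratic form in (ii). -/

section Decomposition

/-- The index paired with `i` by `Ω`. -/
def conjIdx : Equiv.Perm (Fin 6) where
  toFun := ![1, 0, 3, 2, 5, 4]
  invFun := ![1, 0, 3, 2, 5, 4]
  left_inv := by decide
  right_inv := by decide

/-- The sign of the nonzero entry of row `i` of `Ω`. -/
def conjSign : Fin 6 → ℝ := ![1, -1, 1, -1, 1, -1]

@[simp] theorem conjIdx_conjIdx (i : Fin 6) : conjIdx (conjIdx i) = i := conjIdx.left_inv i

@[simp] theorem conjSign_conjIdx (i : Fin 6) : conjSign (conjIdx i) = -conjSign i := by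
  fin_cases i <;> simp [conjIdx, conjSign]

@[simp] theorem conjSign_mul_self (i : Fin 6) : conjSign i * conjSign i = 1 := by
  fin_cases i <;> simp [conjSign]

theorem sum_Om_mul (i : Fin 6) (f : Fin 6 → ℝ) :
    ∑ a, Om i a * f a = conjSign i * f (conjIdx i) := by
  fin_cases i <;> simp [Fin.sum_univ_six, Om, conjSign, conjIdx]

theorem Om_swap (i j : Fin 6) : Om j i = -Om i j := by
  fin_cases i <;> fin_cases j <;> simp [Om]

theorem sum_mul_Om (i : Fin 6) (f : Fin 6 → ℝ) :
    ∑ a, Om a i * f a = -(conjSign i * f (conjIdx i)) := by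
  rw [← sum_Om_mul, ← Finset.sum_neg_distrib]
  exact Finset.sum_congr rfl fun a _ => by rw [Om_swap i a]; ring

/-- `A ↦ A(·, J·, J·)`. -/
def twist : Ten3 →ₗ[ℝ] Ten3 where
  toFun A := ten fun k i j => conjSign i * conjSign j * A (k, conjIdx i, conjIdx j)
  map_add' S T := by ext ⟨i, j, k⟩; simp [mul_add]
  map_smul' c T := by ext ⟨i, j, k⟩; simp; ring

theorem twist_apply (A : Ten3) (k i j : Fin 6) :
    twist A (k, i, j) = conjSign i * conjSign j * A (k, conjIdx i, conjIdx j) := rfl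

/-- `T ↦ T(J·, J·, ·) + T(J·, ·, J·) + T(·, J·, J·)`. -/
def twistSum : Ten3 →ₗ[ℝ] Ten3 where
  toFun T := ten fun i j k => conjSign i * conjSign j * T (conjIdx i, conjIdx j, k)
    + conjSign i * conjSign k * T (conjIdx i, j, conjIdx k)
    + conjSign j * conjSign k * T (i, conjIdx j, conjIdx k)
  map_add' S T := by ext ⟨i, j, k⟩; simp; ring
  map_smul' c T := by ext ⟨i, j, k⟩; simp; ring

theorem twistSum_apply (T : Ten3) (i j k : Fin 6) :
    twistSum T (i, j, k) = conjSign i * conjSign j * T (conjIdx i, conjIdx j, k)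
    + conjSign i * conjSign k * T (conjIdx i, j, conjIdx k)
    + conjSign j * conjSign k * T (i, conjIdx j, conjIdx k) := rfl

theorem prM_eq (A : Ten3) : prM A = (1 / 2 : ℝ) • (A - twist A) := by
  ext ⟨k, i, j⟩
  simp only [prM, LinearMap.coe_mk, AddHom.coe_mk, ten_apply, PiLp.smul_apply, PiLp.sub_apply,
    smul_eq_mul, twist_apply, mul_assoc, ← Finset.mul_sum, sum_Om_mul]

theorem inner_ten3 (S T : Ten3) :
    inner ℝ S T = ∑ i, ∑ j, ∑ k, S (i, j, k) * T (i, j, k) := by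
  rw [PiLp.inner_apply, Fintype.sum_prod_type]
  refine Finset.sum_congr rfl fun i _ => ?_
  rw [Fintype.sum_prod_type]
  simp [mul_comm]

theorem inner_twist (S T : Ten3) : inner ℝ (twist S) T = (inner ℝ S (twist T) : ℝ) := by
  simp only [inner_ten3, twist_apply]
  refine Finset.sum_congr rfl fun k _ => ?_
  rw [← Equiv.sum_comp conjIdx]
  refine Finset.sum_congr rfl fun i _ => ?_
  rw [← Equiv.sum_comp conjIdx]
  refine Finset.sum_congr rfl fun j _ => ?_
  simp only [conjIdx_conjIdx, conjSign_conjIdx]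
  ring

theorem twist_twist (T : Ten3) : twist (twist T) = T := by
  ext ⟨k, i, j⟩
  simp only [twist_apply, conjIdx_conjIdx, conjSign_conjIdx]
  linear_combination (conjSign j * conjSign j * T (k, i, j)) * conjSign_mul_self i
    + T (k, i, j) * conjSign_mul_self j

theorem inner_prM (S T : Ten3) : inner ℝ (prM S) (prM T) = (inner ℝ S (prM T) : ℝ) := by
  simp only [prM_eq, inner_smul_left, inner_smul_right, inner_sub_left, inner_sub_right,
    inner_twist, twist_twist, RCLike.conj_to_real]
  ring

/-- By skew-symmetry the three summands of `twistSum` pair equally with `S`. So on an eigenspace of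
`twistSum` for c, `twist` acts inside inner products of 3-forms as c/3. -/
theorem inner_twistSum {S T : Ten3} (hS : S ∈ Lam3) (hT : T ∈ Lam3) :
    inner ℝ S (twistSum T) = 3 * (inner ℝ S (twist T) : ℝ) := by
  have h1 : ∑ i, ∑ j, ∑ k, S (i, j, k) * (conjSign i * conjSign k * T (conjIdx i, j, conjIdx k))
      = ∑ i, ∑ j, ∑ k, S (i, j, k) * (conjSign j * conjSign k * T (i, conjIdx j, conjIdx k)) := by
    rw [Finset.sum_comm]
    refine Finset.sum_congr rfl fun i _ => Finset.sum_congr rfl fun j _ =>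
      Finset.sum_congr rfl fun k _ => ?_
    rw [(hS j i k).1, (hT (conjIdx j) i (conjIdx k)).1]; ring
  have h2 : ∑ i, ∑ j, ∑ k, S (i, j, k) * (conjSign i * conjSign j * T (conjIdx i, conjIdx j, k))
      = ∑ i, ∑ j, ∑ k, S (i, j, k) * (conjSign i * conjSign k * T (conjIdx i, j, conjIdx k)) := by
    refine Finset.sum_congr rfl fun i _ => ?_
    rw [Finset.sum_comm]
    refine Finset.sum_congr rfl fun j _ => Finset.sum_congr rfl fun k _ => ?_
    rw [(hS i k j).2, (hT (conjIdx i) (conjIdx k) j).2]; ring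
  simp only [inner_ten3, twistSum_apply, twist_apply, mul_add, Finset.sum_add_distrib]
  rw [h2, h1]; ring

theorem inner_twistSum_comm {S T : Ten3} (hS : S ∈ Lam3) (hT : T ∈ Lam3) :
    inner ℝ (twistSum S) T = (inner ℝ S (twistSum T) : ℝ) := by
  rw [real_inner_comm, inner_twistSum hT hS, inner_twistSum hS hT, ← inner_twist, real_inner_comm]

theorem twistSum_mem {T : Ten3} (hT : T ∈ Lam3) : twistSum T ∈ Lam3 := by
  intro i j k
  simp only [twistSum_apply]
  constructor
  · rw [(hT (conjIdx i) (conjIdx j) k).1, (hT (conjIdx i) j (conjIdx k)).1,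
      (hT i (conjIdx j) (conjIdx k)).1]
    ring
  · rw [(hT (conjIdx i) (conjIdx j) k).2, (hT (conjIdx i) j (conjIdx k)).2,
      (hT i (conjIdx j) (conjIdx k)).2]
    ring

/-- The eigenvalues are -3 on pure types (3,0), (0,3), where every pair of J's contributes -1, and
-1 + 1 + 1 = 1 on mixed types. -/
theorem twistSum_twistSum (T : Ten3) : twistSum (twistSum T) = (3 : ℝ) • T - (2 : ℝ) • twistSum T := by
  ext ⟨i, j, k⟩
  simp only [twistSum_apply, PiLp.sub_apply, PiLp.smul_apply, smul_eq_mul, conjIdx_conjIdx,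
    conjSign_conjIdx]
  have hi := conjSign_mul_self i
  have hj := conjSign_mul_self j
  have hk := conjSign_mul_self k
  generalize conjSign i = a at *
  generalize conjSign j = b at *
  generalize conjSign k = c at *
  linear_combination ((b * b + c * c) * T (i, j, k) - 2 * b * c * T (i, conjIdx j, conjIdx k)) * hi
    + ((c * c + 1) * T (i, j, k) - 2 * a * c * T (conjIdx i, j, conjIdx k)) * hj
    + (2 * T (i, j, k) - 2 * a * b * T (conjIdx i, conjIdx j, k)) * hk

theorem tau_apply {T : Ten3} (hT : T ∈ Lam3) (i j k : Fin 6) :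
    tau T (i, j, k) = -(conjSign i * T (conjIdx i, j, k) + conjSign j * T (i, conjIdx j, k)
      + conjSign k * T (i, j, conjIdx k)) := by
  simp only [tau, LinearMap.coe_mk, AddHom.coe_mk, ten_apply, Finset.sum_add_distrib,
    Finset.sum_sub_distrib, sum_mul_Om]
  rw [(hT i (conjIdx j) k).1, (hT i j (conjIdx k)).2, (hT i (conjIdx k) j).1]
  ring

theorem tau_mem {T : Ten3} (hT : T ∈ Lam3) : tau T ∈ Lam3 := by
  intro i j k
  simp only [tau_apply hT]
  constructor
  · rw [(hT (conjIdx i) j k).1, (hT i (conjIdx j) k).1, (hT i j (conjIdx k)).1]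
    ring
  · rw [(hT (conjIdx i) j k).2, (hT i (conjIdx j) k).2, (hT i j (conjIdx k)).2]
    ring

theorem tau_tau {T : Ten3} (hT : T ∈ Lam3) : tau (tau T) = (2 : ℝ) • twistSum T - (3 : ℝ) • T := by
  ext ⟨i, j, k⟩
  simp only [tau_apply (tau_mem hT), tau_apply hT, PiLp.sub_apply, PiLp.smul_apply, smul_eq_mul,
    twistSum_apply, conjIdx_conjIdx, conjSign_conjIdx]
  linear_combination (-T (i, j, k)) * (conjSign_mul_self i + conjSign_mul_self j + conjSign_mul_self k)

theorem mem_Lam2_iff {T : Ten3} (hT : T ∈ Lam3) : T ∈ Lam2 ↔ twistSum T = (-3 : ℝ) • T := by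
  rw [Lam2, Submodule.mem_inf, LinearMap.mem_ker, LinearMap.add_apply, LinearMap.comp_apply,
    LinearMap.smul_apply, LinearMap.id_apply, tau_tau hT]
  constructor
  · rintro ⟨-, h⟩
    have : (2 : ℝ) • (twistSum T + (3 : ℝ) • T) = 0 := by rw [← h]; module
    rw [smul_eq_zero_iff_right two_ne_zero] at this
    rw [eq_neg_of_add_eq_zero_left this]; module
  · rintro h
    refine ⟨hT, ?_⟩
    rw [h]; module

theorem inner_eq_zero_of_twistSum {S T : Ten3} (hS : S ∈ Lam3) (hT : T ∈ Lam3)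
    (h : twistSum S = (-3 : ℝ) • S) (h' : twistSum T = T) : inner ℝ S T = (0 : ℝ) := by
  have := inner_twistSum_comm hS hT
  rw [h, h', inner_smul_left, RCLike.conj_to_real] at this
  linarith

theorem omWedge_apply (X : Fin 6 → ℝ) (i j k : Fin 6) :
    omWedge X (i, j, k) = Om i j * X k - Om i k * X j + Om j k * X i := rfl

theorem omWedge_mem (X : Fin 6 → ℝ) : omWedge X ∈ Lam3 := by
  intro i j k
  simp only [omWedge_apply]
  constructor
  · rw [Om_swap i j]; ring
  · rw [Om_swap j k]; ring

theorem Om_conjIdx_left (i j : Fin 6) :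
    conjSign i * Om (conjIdx i) j = -if i = j then 1 else 0 := by
  fin_cases i <;> fin_cases j <;> simp [Om, conjIdx, conjSign]

theorem Om_conjIdx_right (i j : Fin 6) :
    conjSign j * Om i (conjIdx j) = if i = j then 1 else 0 := by
  fin_cases i <;> fin_cases j <;> simp [Om, conjIdx, conjSign]

theorem twistSum_omWedge (X : Fin 6 → ℝ) : twistSum (omWedge X) = omWedge X := by
  have h3 : ∀ i j, conjSign i * conjSign j * Om (conjIdx i) (conjIdx j) = Om i j := by
    intro i j
    fin_cases i <;> fin_cases j <;> simp [Om, conjIdx, conjSign]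
  ext ⟨i, j, k⟩
  simp only [twistSum_apply, omWedge_apply]
  have a1 := h3 i j
  have a2 := h3 i k
  have a3 := h3 j k
  have b1 := Om_conjIdx_left i j
  have b2 := Om_conjIdx_left i k
  have b3 := Om_conjIdx_left j k
  have c1 := Om_conjIdx_right i j
  have c2 := Om_conjIdx_right i k
  have c3 := Om_conjIdx_right j k
  linear_combination X k * a1 - X j * a2 + X i * a3
    - conjSign j * X (conjIdx j) * b2 + conjSign i * X (conjIdx i) * c3
    + conjSign k * X (conjIdx k) * b1 + conjSign k * X (conjIdx k) * c1 - conjSign j * X (conjIdx j) * c2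
    + conjSign i * X (conjIdx i) * b3

theorem inner_omWedge {T : Ten3} (hT : T ∈ Lam3) (X : Fin 6 → ℝ) :
    inner ℝ T (omWedge X) = 6 * ∑ k, leeVec (fun i j k => T (i, j, k)) k * X k := by
  have h0 : ∀ k, ∑ i, ∑ j, T (i, j, k) * Om i j = 2 * leeVec (fun i j k => T (i, j, k)) k := by
    intro k
    simp [Fin.sum_univ_six, Om, leeVec]
    rw [(hT 1 0 k).1, (hT 3 2 k).1, (hT 5 4 k).1]; ring
  have h1 : ∑ k, ∑ i, ∑ j, T (i, j, k) * (Om i j * X k) =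
      2 * ∑ k, leeVec (fun i j k => T (i, j, k)) k * X k := by
    simp only [← mul_assoc, ← Finset.sum_mul, h0, Finset.mul_sum]
  have h2 : ∑ i, ∑ j, ∑ k, T (i, j, k) * (Om i j * X k) =
      2 * ∑ k, leeVec (fun i j k => T (i, j, k)) k * X k := by
    rw [← h1, Finset.sum_congr rfl fun i _ => Finset.sum_comm, Finset.sum_comm]
  have h3 : ∑ i, ∑ j, ∑ k, T (i, j, k) * (Om i k * X j) =
      -(2 * ∑ k, leeVec (fun i j k => T (i, j, k)) k * X k) := by
    rw [← h2, Finset.sum_congr rfl fun i _ => Finset.sum_comm]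
    simp only [← Finset.sum_neg_distrib]
    refine Finset.sum_congr rfl fun i _ => Finset.sum_congr rfl fun j _ =>
      Finset.sum_congr rfl fun k _ => ?_
    rw [(hT i k j).2]; ring
  have h4 : ∑ i, ∑ j, ∑ k, T (i, j, k) * (Om j k * X i) =
      2 * ∑ k, leeVec (fun i j k => T (i, j, k)) k * X k := by
    rw [← h1]
    refine Finset.sum_congr rfl fun i _ => Finset.sum_congr rfl fun j _ =>
      Finset.sum_congr rfl fun k _ => ?_
    rw [(hT i j k).1, (hT j i k).2]; ring
  simp only [inner_ten3, omWedge_apply, mul_add, mul_sub, Finset.sum_add_distrib,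
    Finset.sum_sub_distrib]
  rw [h2, h3, h4]; ring

theorem leeVec_omWedge (X : Fin 6 → ℝ) (k : Fin 6) :
    leeVec (fun i j k => omWedge X (i, j, k)) k = 2 * X k := by
  fin_cases k <;> simp [leeVec, omWedge_apply, Om] <;> ring

theorem Lam6_mem {T : Ten3} (hT : T ∈ Lam6) : T ∈ Lam3 ∧ twistSum T = T := by
  obtain ⟨X, rfl⟩ := hT
  exact ⟨omWedge_mem X, twistSum_omWedge X⟩

/-- The polynomial (1 - x)/4 is 1 at the eigenvalue -3 and 0 at 1, so this is the spectral
projection. -/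
theorem mem_Lam2 {T : Ten3} (hT : T ∈ Lam3) :
    (1 / 4 : ℝ) • (T - twistSum T) ∈ Lam2 := by
  rw [mem_Lam2_iff (Lam3.smul_mem _ (Lam3.sub_mem hT (twistSum_mem hT)))]
  rw [map_smul, map_sub, twistSum_twistSum]
  module

/-- The projection P of T to `Lam2` is orthogonal to T by definition and to T - P by the
eigenvalues, hence zero. -/
theorem Lam12_mem {T : Ten3} (hT : T ∈ Lam12) : T ∈ Lam3 ∧ twistSum T = T := by
  obtain ⟨h3, ho⟩ := hT
  refine ⟨h3, ?_⟩
  have hp := (mem_Lam2 h3)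
  set P := (1 / 4 : ℝ) • (T - twistSum T) with hP
  have hP3 : P ∈ Lam3 := hp.1
  have h1 : inner ℝ P T = (0 : ℝ) := ho P (Submodule.mem_sup_left hp)
  have h2 : inner ℝ P (T - P) = (0 : ℝ) :=
    inner_eq_zero_of_twistSum hP3 (Lam3.sub_mem h3 hP3) ((mem_Lam2_iff hP3).1 hp) (by
      rw [map_sub, hP, map_smul, map_sub, twistSum_twistSum]; module)
  rw [inner_sub_right, h1, zero_sub, neg_eq_zero, inner_self_eq_zero] at h2
  rw [h2, eq_comm, smul_eq_zero_iff_right (by norm_num), sub_eq_zero] at hP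
  exact hP.symm

/-- The map `prM` scales inner products by 1 on pure types (c = -3) and by 1/3 on mixed types (c =
1), so orthogonal components keep orthogonal images. -/
theorem inner_prM_of_twistSum {S T : Ten3} (hS : S ∈ Lam3) (hT : T ∈ Lam3) {c : ℝ}
    (h : twistSum T = c • T) : inner ℝ (prM S) (prM T) = (3 - c) / 6 * (inner ℝ S T : ℝ) := by
  have := inner_twistSum hS hT
  rw [h, inner_smul_right] at this
  rw [inner_prM, prM_eq, inner_smul_right, inner_sub_right]
  linarith

/-- By this scaling, θ sends 3-forms orthogonal to `L` to tensors orthogonal to θ(L), and c < 3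
makes it injective on `L`. Projecting the image therefore recovers the `L`-component of the form. -/
theorem formComponent_theta {L : Submodule ℝ Ten3} (hL : L ≤ Lam3) {c : ℝ} (hc : c < 3)
    (hLc : ∀ S ∈ L, twistSum S = c • S) {S R : Ten3} (hS : S ∈ L) (hR : R ∈ Lam3)
    (h : ∀ U ∈ L, inner ℝ R U = (0 : ℝ)) : formComponent L (theta (S + R)) = S := by
  have hinj : Set.InjOn theta (L : Set Ten3) := by
    intro U hU V hV hUV
    have hd : U - V ∈ L := L.sub_mem hU hV
    have h0 : prM (U - V) = 0 := by
      have : theta (U - V) = 0 := by rw [map_sub, hUV, sub_self]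
      simpa [theta] using this
    have h1 := inner_prM_of_twistSum (hL hd) (hL hd) (hLc _ hd)
    rw [h0, inner_zero_left, eq_comm, mul_eq_zero, inner_self_eq_zero, sub_eq_zero] at h1
    exact h1.resolve_left (by linarith [hc] : (3 - c) / 6 ≠ 0)
  have hp : (L.map theta).starProjection (theta (S + R)) = theta S := by
    refine Submodule.eq_starProjection_of_mem_of_inner_eq_zero ⟨S, hS, rfl⟩ ?_
    rintro _ ⟨U, hU, rfl⟩
    rw [map_add, add_sub_cancel_left, theta, LinearMap.smul_apply, LinearMap.smul_apply,
      inner_smul_left, inner_smul_right, inner_prM_of_twistSum hR (hL hU) (hLc _ hU), h U hU]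
    simp
  rw [formComponent, hp]
  exact hinj.leftInvOn_invFunOn hS

/-- Stated in an additive monoid so as to serve both the norm of a 3-form and its Clifford element.
-/
theorem sum_eq_six_nsmul {E : Type*} [AddCommMonoid E] {n : ℕ} (F : Fin n → Fin n → Fin n → E)
    (h1 : ∀ i j k, F i j k = F j i k) (h2 : ∀ i j k, F i j k = F i k j) (h0 : ∀ i k, F i i k = 0) :
    ∑ i, ∑ j, ∑ k, F i j k =
      6 • ∑ i, ∑ j ∈ Finset.Ioi i, ∑ k ∈ Finset.Ioi j, F i j k := by
  let G : Fin n → Fin n → Fin n → E := fun i j k => if i < j then if j < k then F i j k else 0 else 0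
  have hG : ∑ i, ∑ j ∈ Finset.Ioi i, ∑ k ∈ Finset.Ioi j, F i j k = ∑ i, ∑ j, ∑ k, G i j k := by
    refine Finset.sum_congr rfl fun i _ => ?_
    rw [← Finset.filter_lt_eq_Ioi, Finset.sum_filter]
    refine Finset.sum_congr rfl fun j _ => ?_
    rw [← Finset.filter_lt_eq_Ioi, Finset.sum_filter]
    by_cases h : i < j <;> simp [G, h]
  have h0' : ∀ i k, F i k k = 0 := fun i k => by rw [h1, h2, h0]
  have h0'' : ∀ i k, F i k i = 0 := fun i k => by rw [h2, h0]
  have hF : ∀ i j k, F i j k =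
      G i j k + G i k j + G j i k + G j k i + G k i j + G k j i := by
    intro i j k
    have e1 := h1 i j k
    have e2 := h2 i j k
    have e3 : F i j k = F j k i := by rw [h1, h2]
    have e4 : F i j k = F k i j := by rw [h2, h1]
    have e5 : F i j k = F k j i := by rw [h2, h1, h2]
    rcases lt_trichotomy i j with hij | rfl | hij
    · rcases lt_trichotomy j k with hjk | rfl | hjk
      · simp [G, hij, hjk, hij.not_gt, hjk.not_gt, (hij.trans hjk).not_gt]
      · simp [G, h0', h0'']
      · rcases lt_trichotomy i k with hik | rfl | hik
        · simp [G, hij, hjk, hik, hij.not_gt, hjk.not_gt, hik.not_gt, ← e2]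
        · simp [G, h0'']
        · simp [G, hij, hjk, hik, hij.not_gt, hjk.not_gt, hik.not_gt, ← e4]
    · simp [G, h0, h0'']
    · rcases lt_trichotomy j k with hjk | rfl | hjk
      · rcases lt_trichotomy i k with hik | rfl | hik
        · simp [G, hij, hjk, hik, hij.not_gt, hjk.not_gt, hik.not_gt, ← e1]
        · simp [G, h0'']
        · simp [G, hij, hjk, hik, hij.not_gt, hjk.not_gt, hik.not_gt, ← e3]
      · simp [G, h0', h0'']
      · simp [G, hij, hjk, hij.not_gt, hjk.not_gt, (hjk.trans hij).not_gt, ← e5]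
  have c1 : ∀ H : Fin n → Fin n → Fin n → E, ∑ i, ∑ j, ∑ k, H i j k = ∑ i, ∑ j, ∑ k, H i k j :=
    fun H => Finset.sum_congr rfl fun i _ => Finset.sum_comm
  have c2 : ∀ H : Fin n → Fin n → Fin n → E, ∑ i, ∑ j, ∑ k, H i j k = ∑ i, ∑ j, ∑ k, H j i k :=
    fun H => Finset.sum_comm
  rw [hG, Finset.sum_congr rfl fun i _ => Finset.sum_congr rfl fun j _ =>
    Finset.sum_congr rfl fun k _ => hF i j k]
  simp only [Finset.sum_add_distrib]
  rw [← c1 G, ← c2 G, ← (c2 G).trans (c1 fun i j k => G j i k), ← (c1 G).trans (c2 fun i j k => G i k j),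
    ← ((c1 G).trans (c2 fun i j k => G i k j)).trans (c1 fun i j k => G j k i)]
  abel

theorem inner_self_Lam3 {T : Ten3} (hT : T ∈ Lam3) : inner ℝ T T = 6 * formNormSq T := by
  rw [inner_ten3, sum_eq_six_nsmul, formNormSq, nsmul_eq_mul]
  · simp [sq]
  · intro i j k; rw [(hT i j k).1]; ring
  · intro i j k; rw [(hT i j k).2]; ring
  · intro i k
    have : T (i, i, k) = 0 := by linarith [(hT i i k).1]
    rw [this, mul_zero]

/-- For each contracted index m this is an identity for the 2-form β = T(·,·,e_m), relating the
pairing of β ∧ β with Ω ∧ Ω to the squared Ω-trace of β and the pairing of β with β(J·, J·). -/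
theorem twelve_sigTrace {T : Ten3} (hT : T ∈ Lam3) :
    12 * sigTrace (fun i j k => T (i, j, k)) =
      6 * ∑ k, leeVec (fun i j k => T (i, j, k)) k ^ 2 - 3 * inner ℝ T (twist T) := by
  have hc : inner ℝ T (twist T) = ∑ m, ∑ i, ∑ j,
      T (i, j, m) * (conjSign i * conjSign j * T (conjIdx i, conjIdx j, m)) := by
    simp only [inner_ten3, twist_apply]
    refine Finset.sum_congr rfl fun m _ => Finset.sum_congr rfl fun i _ =>
      Finset.sum_congr rfl fun j _ => ?_
    rw [(hT m i j).1, (hT i m j).2, (hT m _ _).1, (hT _ m _).2]; ring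
  rw [hc, sigTrace, sig, sig, sig, ← Finset.sum_add_distrib, ← Finset.sum_add_distrib,
    Finset.mul_sum, Finset.mul_sum, Finset.mul_sum, ← Finset.sum_sub_distrib]
  refine Finset.sum_congr rfl fun m _ => ?_
  have d : ∀ i, T (i, i, m) = 0 := fun i => by linarith [(hT i i m).1]
  have s : ∀ i j, T (i, j, m) = -T (j, i, m) := fun i j => (hT i j m).1
  simp [Fin.sum_univ_six, conjSign, conjIdx, leeVec, d, s 1 0, s 2 0, s 3 0, s 4 0, s 5 0, s 2 1,
    s 3 1, s 4 1, s 5 1, s 3 2, s 4 2, s 5 2, s 4 3, s 5 3, s 5 4]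
  ring

/-- The components of the intrinsic torsion of the 3-form `T`, and the resulting quadratic form. -/
theorem formComponent_combination {T : Ten3} (hT : T ∈ Lam3) :
    3 * formNormSq (formComponent Lam2 (theta T)) - formNormSq (formComponent Lam12 (theta T))
      + formNormSq (formComponent Lam6 (theta T)) = 2 * sigTrace fun i j k => T (i, j, k) := by
  set P := (1 / 4 : ℝ) • (T - twistSum T) with hP
  -- The trace of Ω ∧ X is 2X, so half the trace of T makes the remainder `R` trace free.
  set X : Fin 6 → ℝ := fun k => leeVec (fun i j k => T (i, j, k)) k / 2 with hX
  set R := T - P - omWedge X with hR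
  have hP2 : P ∈ Lam2 := mem_Lam2 hT
  have hP3 : P ∈ Lam3 := hP2.1
  have hW3 := omWedge_mem X
  have hR3 : R ∈ Lam3 := Lam3.sub_mem (Lam3.sub_mem hT hP3) hW3
  have l2 : ∀ S ∈ Lam2, twistSum S = (-3 : ℝ) • S := fun S hS => (mem_Lam2_iff hS.1).1 hS
  have hTP : twistSum (T - P) = T - P := by
    rw [map_sub, hP, map_smul, map_sub, twistSum_twistSum]; module
  have hRR : twistSum R = R := by rw [hR, map_sub, hTP, twistSum_omWedge]
  have o2 : ∀ S ∈ Lam2, ∀ U ∈ Lam3, twistSum U = U → inner ℝ S U = (0 : ℝ) := fun S hS U hU h =>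
    inner_eq_zero_of_twistSum hS.1 hU (l2 S hS) h
  have oR6 : ∀ Y, inner ℝ R (omWedge Y) = (0 : ℝ) := fun Y => by
    rw [hR, inner_sub_left, inner_sub_left, inner_omWedge hT, inner_omWedge hW3,
      o2 P hP2 _ (omWedge_mem Y) (twistSum_omWedge Y)]
    simp only [leeVec_omWedge, hX]
    rw [sub_zero, ← mul_sub, ← Finset.sum_sub_distrib]
    refine mul_eq_zero_of_right _ (Finset.sum_eq_zero fun k _ => by ring)
  have hR12 : R ∈ Lam12 := by
    refine ⟨hR3, ?_⟩
    refine (Submodule.mem_orthogonal _ _).2 fun U hU => ?_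
    obtain ⟨S, hS, _, ⟨Y, rfl⟩, rfl⟩ := Submodule.mem_sup.1 hU
    rw [inner_add_left, o2 S hS R hR3 hRR, real_inner_comm, oR6, add_zero]
  have c2 : formComponent Lam2 (theta T) = P := by
    have := formComponent_theta (L := Lam2) (fun S hS => hS.1) (by norm_num) l2 hP2
      (Lam3.sub_mem hT hP3) fun U hU => by
        rw [real_inner_comm]; exact o2 U hU _ (Lam3.sub_mem hT hP3) hTP
    rwa [add_sub_cancel] at this
  have c12 : formComponent Lam12 (theta T) = R := by
    have := formComponent_theta (L := Lam12) (fun S hS => hS.1) (c := 1) (by norm_num)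
      (fun S hS => by rw [(Lam12_mem hS).2, one_smul]) hR12 (Lam3.add_mem hP3 hW3) fun U hU => by
        have := hU.2 (P + omWedge X) (Submodule.add_mem_sup hP2 ⟨X, rfl⟩)
        exact this
    rwa [show R + (P + omWedge X) = T by rw [hR]; abel] at this
  have c6 : formComponent Lam6 (theta T) = omWedge X := by
    have := formComponent_theta (L := Lam6) (fun S hS => (Lam6_mem hS).1) (c := 1) (by norm_num)
      (fun S hS => by rw [(Lam6_mem hS).2, one_smul]) ⟨X, rfl⟩ (Lam3.add_mem hP3 hR3) fun U hU => by
        obtain ⟨Y, rfl⟩ := hU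
        rw [inner_add_left, oR6, o2 P hP2 _ (omWedge_mem Y) (twistSum_omWedge Y), add_zero]
    rwa [show omWedge X + (P + R) = T by rw [hR]; abel] at this
  rw [c2, c12, c6]
  have n2 := inner_self_Lam3 hP3
  have n12 := inner_self_Lam3 hR3
  have n6 := inner_self_Lam3 hW3
  have e6 : inner ℝ (omWedge X) (omWedge X) =
      3 * ∑ k, leeVec (fun i j k => T (i, j, k)) k ^ 2 := by
    rw [inner_omWedge hW3]
    simp only [leeVec_omWedge, hX, Finset.mul_sum]
    exact Finset.sum_congr rfl fun k _ => by ring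
  have e2 : inner ℝ P P = 1 / 4 * (inner ℝ T T - 3 * inner ℝ T (twist T) : ℝ) := by
    have h1 := o2 P hP2 _ (Lam3.sub_mem hT hP3) hTP
    rw [inner_sub_right, sub_eq_zero] at h1
    rw [← h1, real_inner_comm, hP, inner_smul_right, inner_sub_right, inner_twistSum hT hT]
  have e12 : inner ℝ T T = inner ℝ P P + inner ℝ R R + (inner ℝ (omWedge X) (omWedge X) : ℝ) := by
    have hTs : T = P + R + omWedge X := by rw [hR]; abel
    have h1 := o2 P hP2 R hR3 hRR
    have h2 := o2 P hP2 _ hW3 (twistSum_omWedge X)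
    have h3 := oR6 X
    have h1' := h1; have h2' := h2; have h3' := h3
    rw [real_inner_comm] at h1' h2' h3'
    conv_lhs => rw [hTs]
    simp only [inner_add_left, inner_add_right, h1, h2, h3, h1', h2', h3']
    ring
  -- With W = Ω ∧ X, the left side is (4⟨P,P⟩ + 2⟨W,W⟩ - ⟨T,T⟩)/6 in tensor inner products, and
  -- ⟨T,T⟩ cancels against `e2`.
  have := twelve_sigTrace hT
  linarith

end Decomposition

/-! ### The square of a 3-form in the Clifford algebra. -/

section Clifford

variable {t : Fin 6 → Fin 6 → Fin 6 → ℝ}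

theorem clE_mul_clE (i j : Fin 6) :
    clE i * clE j = -(clE j * clE i) - (if i = j then (2 : ℝ) else 0) • (1 : Cl6) := by
  have h := CliffordAlgebra.ι_mul_ι_add_swap
    (Q := QuadraticMap.weightedSumSquares ℝ (fun _ : Fin 6 => (-1 : ℝ)))
    (Pi.single i 1) (Pi.single j 1)
  have hp : QuadraticMap.polar (QuadraticMap.weightedSumSquares ℝ (fun _ : Fin 6 => (-1 : ℝ)))
      (Pi.single i 1) (Pi.single j 1) = -(if i = j then (2 : ℝ) else 0) := by
    simp only [QuadraticMap.polar, QuadraticMap.weightedSumSquares_apply, Pi.add_apply,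
      ← Finset.sum_sub_distrib]
    rw [Finset.sum_eq_single i]
    · rcases eq_or_ne i j with rfl | hij
      · simp; norm_num
      · simp [hij]
    · intro b _ hb
      simp [hb]
    · simp
  rw [hp, map_neg, Algebra.algebraMap_eq_smul_one] at h
  rw [sub_eq_add_neg, ← h, clE, clE]
  abel

/-- `∑ t_ijk e_i e_j e_k`. -/
def cubic (t : Fin 6 → Fin 6 → Fin 6 → ℝ) : Cl6 :=
  ∑ i, ∑ j, ∑ k, t i j k • (clE i * clE j * clE k)

/-- `∑ t_ljk e_j e_k`. -/
def quadratic (t : Fin 6 → Fin 6 → Fin 6 → ℝ) (l : Fin 6) : Cl6 :=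
  ∑ j, ∑ k, t l j k • (clE j * clE k)

theorem clE_mul_three (a b j : Fin 6) : clE a * clE b * clE j =
    clE j * (clE a * clE b) - (if b = j then (2 : ℝ) else 0) • clE a
      + (if a = j then (2 : ℝ) else 0) • clE b := by
  rw [mul_assoc, clE_mul_clE b j, mul_sub, mul_neg, ← mul_assoc, clE_mul_clE a j]
  simp only [sub_mul, neg_mul, smul_mul_assoc, mul_smul_comm, mul_one, one_mul, mul_assoc]
  abel

theorem clE_mul_four (i j k l : Fin 6) : clE i * clE j * clE k * clE l =
    -(clE l * (clE i * clE j * clE k)) - (if k = l then (2 : ℝ) else 0) • (clE i * clE j)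
      + (if j = l then (2 : ℝ) else 0) • (clE i * clE k)
      - (if i = l then (2 : ℝ) else 0) • (clE j * clE k) := by
  rw [mul_assoc (clE i), mul_assoc (clE i), clE_mul_three j k l]
  simp only [mul_add, mul_sub, mul_smul_comm]
  rw [← mul_assoc, clE_mul_clE i l]
  simp only [sub_mul, neg_mul, smul_mul_assoc, one_mul, mul_assoc]
  abel

theorem quadratic_mul_clE (ht : IsSkew t) (k j : Fin 6) :
    quadratic t k * clE j = clE j * quadratic t k + (4 : ℝ) • ∑ b, t k j b • clE b := by
  have h : ∀ a b, (t k a b • (clE a * clE b)) * clE j = clE j * (t k a b • (clE a * clE b))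
      + ((if a = j then (2 * t k a b) • clE b else 0)
        - (if b = j then (2 * t k a b) • clE a else 0)) := by
    intro a b
    rw [smul_mul_assoc, clE_mul_three, mul_smul_comm]
    split_ifs <;> module
  simp only [quadratic, Finset.sum_mul, Finset.mul_sum, h, Finset.sum_add_distrib,
    Finset.sum_sub_distrib]
  congr 1
  rw [Finset.sum_comm]
  simp only [Finset.sum_ite_eq', Finset.mem_univ, if_true]
  rw [← Finset.sum_sub_distrib, Finset.smul_sum]
  refine Finset.sum_congr rfl fun b _ => ?_
  rw [(ht k b j).2]
  module

/-- Moving `clE l` past three generators gives a sign, and each of the three positions contributes a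
contraction 2 `quadratic t l`. -/
theorem cubic_mul_clE (ht : IsSkew t) (l : Fin 6) :
    cubic t * clE l = -(clE l * cubic t) - (6 : ℝ) • quadratic t l := by
  have h : ∀ i j k, (t i j k • (clE i * clE j * clE k)) * clE l =
      -(clE l * (t i j k • (clE i * clE j * clE k)))
      - (if k = l then (2 * t i j k) • (clE i * clE j) else 0)
      + (if j = l then (2 * t i j k) • (clE i * clE k) else 0)
      - (if i = l then (2 * t i j k) • (clE j * clE k) else 0) := by
    intro i j k
    rw [smul_mul_assoc, clE_mul_four, mul_smul_comm]
    split_ifs <;> module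
  have e1 : ∑ i, ∑ j, ∑ k, (if k = l then (2 * t i j k) • (clE i * clE j) else 0) =
      (2 : ℝ) • quadratic t l := by
    simp only [Finset.sum_ite_eq', Finset.mem_univ, if_true, quadratic, Finset.smul_sum]
    refine Finset.sum_congr rfl fun i _ => Finset.sum_congr rfl fun j _ => ?_
    rw [(ht i j l).2, (ht i l j).1, neg_neg, smul_smul]
  have e2 : ∑ i, ∑ j, ∑ k, (if j = l then (2 * t i j k) • (clE i * clE k) else 0) =
      -((2 : ℝ) • quadratic t l) := by
    rw [Finset.sum_congr rfl fun i _ => Finset.sum_comm]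
    simp only [Finset.sum_ite_eq', Finset.mem_univ, if_true, quadratic, Finset.smul_sum,
      ← Finset.sum_neg_distrib]
    refine Finset.sum_congr rfl fun i _ => Finset.sum_congr rfl fun j _ => ?_
    rw [(ht i l j).1]
    module
  have e3 : ∑ i, ∑ j, ∑ k, (if i = l then (2 * t i j k) • (clE j * clE k) else 0) =
      (2 : ℝ) • quadratic t l := by
    rw [Finset.sum_comm, Finset.sum_congr rfl fun i _ => Finset.sum_comm]
    simp only [Finset.sum_ite_eq', Finset.mem_univ, if_true, quadratic, Finset.smul_sum, smul_smul]
  simp only [cubic, Finset.sum_mul, Finset.mul_sum, h, Finset.sum_add_distrib,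
    Finset.sum_sub_distrib, Finset.sum_neg_distrib, e1, e2, e3]
  module

theorem cubic_eq (t : Fin 6 → Fin 6 → Fin 6 → ℝ) : cubic t = ∑ l, clE l * quadratic t l := by
  simp only [cubic, quadratic, Finset.mul_sum, mul_smul_comm, mul_assoc]

theorem cubic_mul_quadratic (ht : IsSkew t) (l : Fin 6) :
    cubic t * quadratic t l = quadratic t l * cubic t
      + (6 : ℝ) • ∑ j, ∑ k, t l j k • (clE j * quadratic t k + quadratic t k * clE j) := by
  have h : ∀ j k, cubic t * (t l j k • (clE j * clE k)) = (t l j k • (clE j * clE k)) * cubic t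
      + (6 : ℝ) • (t l j k • (clE j * quadratic t k)) - (6 : ℝ) • (t l j k • (quadratic t j * clE k)) := by
    intro j k
    rw [mul_smul_comm, ← mul_assoc, cubic_mul_clE ht, sub_mul, neg_mul, mul_assoc,
      cubic_mul_clE ht, smul_mul_assoc, smul_mul_assoc, mul_sub, mul_neg, mul_smul_comm, mul_assoc]
    module
  conv_lhs => rw [quadratic]
  conv_rhs => enter [1]; rw [quadratic]
  simp only [Finset.mul_sum, Finset.sum_mul, h, Finset.sum_add_distrib, Finset.sum_sub_distrib,
    smul_add, Finset.smul_sum]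
  rw [add_sub_assoc, sub_eq_add_neg]
  congr 2
  rw [Finset.sum_comm]
  simp only [← Finset.sum_neg_distrib]
  refine Finset.sum_congr rfl fun j _ => Finset.sum_congr rfl fun k _ => ?_
  rw [(ht l k j).2]
  module

/-- Off-diagonal terms cancel in pairs, and the diagonal ones use e_i² = -1. -/
theorem sum_symm_smul {q : Fin 6 → Fin 6 → ℝ} (hq : ∀ i j, q i j = q j i) :
    ∑ i, ∑ j, q i j • (clE i * clE j) = -((∑ i, q i i) • (1 : Cl6)) := by
  have h : ∑ i, ∑ j, q i j • (clE i * clE j) =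
      -(∑ i, ∑ j, q i j • (clE i * clE j)) - (2 : ℝ) • (∑ i, q i i) • (1 : Cl6) := by
    conv_rhs => rw [Finset.sum_comm]
    rw [Finset.sum_smul, Finset.smul_sum, ← Finset.sum_neg_distrib, ← Finset.sum_sub_distrib]
    refine Finset.sum_congr rfl fun i _ => ?_
    have : ∀ j, q i j • (clE i * clE j) = -(q j i • (clE j * clE i)) -
        if i = j then (2 : ℝ) • q i i • (1 : Cl6) else 0 := by
      intro j
      rw [clE_mul_clE i j, hq j i]
      split_ifs with h
      · subst h; module
      · module
    rw [Finset.sum_congr rfl fun j _ => this j, Finset.sum_sub_distrib, Finset.sum_neg_distrib,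
      Finset.sum_ite_eq]
    simp
  have h2 : (2 : ℝ) • ∑ i, ∑ j, q i j • (clE i * clE j) =
      (2 : ℝ) • -((∑ i, q i i) • (1 : Cl6)) := by
    rw [two_smul]
    nth_rewrite 1 [h]
    module
  exact smul_right_injective _ two_ne_zero h2

/-- One factor is written as the sum of e_l · `quadratic t l`. Moving the other factor through it
reproduces -`cubic t ^ 2` plus contractions, so the degree six part disappears and the square is
half of the contractions. -/
theorem cubic_sq (ht : IsSkew t) : cubic t ^ 2 = -((9 : ℝ) • ∑ l, quadratic t l ^ 2)
    - (12 * ∑ i, ∑ j, ∑ k, t i j k ^ 2) • (1 : Cl6) := by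
  have a1 : ∑ l, ∑ j, ∑ k, t l j k • (clE l * (clE j * quadratic t k)) = ∑ l, quadratic t l ^ 2 := by
    rw [Finset.sum_congr rfl fun i _ => Finset.sum_comm, Finset.sum_comm]
    refine Finset.sum_congr rfl fun k _ => ?_
    rw [sq]
    conv_rhs => enter [1]; rw [quadratic]
    simp only [Finset.sum_mul, smul_mul_assoc, ← mul_assoc]
    refine Finset.sum_congr rfl fun i _ => Finset.sum_congr rfl fun j _ => ?_
    rw [(ht i j k).2, (ht i k j).1, neg_neg]
  have a2 : ∑ l, ∑ j, ∑ k, t l j k • (clE l * ∑ b, t k j b • clE b) =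
      (∑ i, ∑ j, ∑ k, t i j k ^ 2) • (1 : Cl6) := by
    have : ∀ l, ∑ j, ∑ k, t l j k • (clE l * ∑ b, t k j b • clE b) =
        ∑ b, (-∑ j, ∑ k, t l j k * t b j k) • (clE l * clE b) := by
      intro l
      simp only [Finset.mul_sum, Finset.smul_sum, mul_smul_comm, smul_smul, ← Finset.sum_neg_distrib,
        Finset.sum_smul]
      rw [Finset.sum_congr rfl fun i _ => Finset.sum_comm, Finset.sum_comm]
      refine Finset.sum_congr rfl fun b _ => Finset.sum_congr rfl fun j _ =>
        Finset.sum_congr rfl fun k _ => ?_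
      rw [(ht k j b).2, (ht k b j).1, (ht b k j).2, neg_neg, mul_neg]
    rw [Finset.sum_congr rfl fun l _ => this l, sum_symm_smul]
    · simp [sq]
    · intro i j; simp only [mul_comm]
  have h : cubic t ^ 2 = -cubic t ^ 2 - (18 : ℝ) • ∑ l, quadratic t l ^ 2
      - (24 * ∑ i, ∑ j, ∑ k, t i j k ^ 2) • (1 : Cl6) := by
    have h1 : ∀ l, cubic t * (clE l * quadratic t l) = -((clE l * quadratic t l) * cubic t)
        - (12 : ℝ) • (∑ j, ∑ k, t l j k • (clE l * (clE j * quadratic t k)))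
        - (24 : ℝ) • (∑ j, ∑ k, t l j k • (clE l * ∑ b, t k j b • clE b))
        - (6 : ℝ) • quadratic t l ^ 2 := by
      intro l
      have hx : ∑ j, ∑ k, t l j k • (clE j * quadratic t k + quadratic t k * clE j) =
          (2 : ℝ) • (∑ j, ∑ k, t l j k • (clE j * quadratic t k))
          + (4 : ℝ) • ∑ j, ∑ k, t l j k • ∑ b, t k j b • clE b := by
        simp only [Finset.smul_sum (r := (2 : ℝ)), Finset.smul_sum (r := (4 : ℝ)),
          ← Finset.sum_add_distrib]
        refine Finset.sum_congr rfl fun j _ => Finset.sum_congr rfl fun k _ => ?_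
        rw [quadratic_mul_clE ht]
        module
      have hm1 : clE l * ∑ j, ∑ k, t l j k • (clE j * quadratic t k) =
          ∑ j, ∑ k, t l j k • (clE l * (clE j * quadratic t k)) := by
        simp only [Finset.mul_sum, mul_smul_comm]
      have hm2 : clE l * ∑ j, ∑ k, t l j k • ∑ b, t k j b • clE b =
          ∑ j, ∑ k, t l j k • (clE l * ∑ b, t k j b • clE b) := by
        simp only [Finset.mul_sum (a := clE l) (s := Finset.univ) (f := fun j => ∑ k, t l j k • ∑ b, t k j b • clE b)]
        refine Finset.sum_congr rfl fun j _ => ?_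
        rw [Finset.mul_sum]
        refine Finset.sum_congr rfl fun k _ => ?_
        rw [mul_smul_comm]
      rw [← mul_assoc, cubic_mul_clE ht, sub_mul, neg_mul, mul_assoc, cubic_mul_quadratic ht, hx,
        smul_mul_assoc, ← sq, mul_add, mul_smul_comm, mul_add, mul_smul_comm, mul_smul_comm, hm1,
        hm2, mul_assoc]
      module
    rw [sq]
    conv_lhs => enter [2]; rw [cubic_eq]
    rw [Finset.mul_sum, Finset.sum_congr rfl fun l _ => h1 l]
    simp only [Finset.sum_sub_distrib, Finset.sum_neg_distrib, ← Finset.smul_sum, a1, a2,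
      ← Finset.sum_mul, ← cubic_eq]
    module
  have h2 : (2 : ℝ) • cubic t ^ 2 = (2 : ℝ) • (-((9 : ℝ) • ∑ l, quadratic t l ^ 2)
    - (12 * ∑ i, ∑ j, ∑ k, t i j k ^ 2) • (1 : Cl6)) := by
    rw [two_smul]
    nth_rewrite 1 [h]
    module
  exact smul_right_injective _ two_ne_zero h2

/-- `∑_l t_ljk t_lmn`. -/
def contr (t : Fin 6 → Fin 6 → Fin 6 → ℝ) (j k m n : Fin 6) : ℝ := ∑ l, t l j k * t l m n

theorem contr_swap_left (ht : IsSkew t) (j k m n : Fin 6) : contr t k j m n = -contr t j k m n := by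
  simp only [contr, ← Finset.sum_neg_distrib]
  exact Finset.sum_congr rfl fun l _ => by rw [(ht l k j).2, neg_mul]

theorem contr_swap_right (ht : IsSkew t) (j k m n : Fin 6) : contr t j k n m = -contr t j k m n := by
  simp only [contr, ← Finset.sum_neg_distrib]
  exact Finset.sum_congr rfl fun l _ => by rw [(ht l n m).2, mul_neg]

theorem contr_comm (j k m n : Fin 6) : contr t m n j k = contr t j k m n := by
  simp only [contr, mul_comm]

theorem sig_eq_contr (ht : IsSkew t) (i j k l : Fin 6) :
    sig t i j k l = contr t i j k l + contr t j k i l + contr t k i j l := by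
  have h : ∀ i j m, t i j m = t m i j := fun i j m => by rw [(ht i j m).2, (ht i m j).1, neg_neg]
  simp only [sig, contr, ← Finset.sum_add_distrib]
  refine Finset.sum_congr rfl fun m _ => ?_
  rw [h i j m, h k l m, h j k m, h i l m, h k i m, h j l m]

theorem sum_quadratic_sq (t : Fin 6 → Fin 6 → Fin 6 → ℝ) : ∑ l, quadratic t l ^ 2 =
    ∑ j, ∑ k, ∑ m, ∑ n, contr t j k m n • (clE j * clE k * clE m * clE n) := by
  have h : ∀ l, quadratic t l ^ 2 =
      ∑ j, ∑ k, ∑ m, ∑ n, (t l j k * t l m n) • (clE j * clE k * clE m * clE n) := by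
    intro l
    rw [sq, quadratic, Finset.sum_mul]
    refine Finset.sum_congr rfl fun j _ => ?_
    rw [Finset.sum_mul]
    refine Finset.sum_congr rfl fun k _ => ?_
    rw [Finset.mul_sum]
    refine Finset.sum_congr rfl fun m _ => ?_
    rw [Finset.mul_sum]
    refine Finset.sum_congr rfl fun n _ => ?_
    rw [smul_mul_smul_comm, ← mul_assoc]
  simp only [h, contr, Finset.sum_smul]
  rw [Finset.sum_comm]
  refine Finset.sum_congr rfl fun j _ => ?_
  rw [Finset.sum_comm]
  refine Finset.sum_congr rfl fun k _ => ?_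
  rw [Finset.sum_comm]
  refine Finset.sum_congr rfl fun m _ => ?_
  rw [Finset.sum_comm]

/-- `contr t` has the symmetries of a curvature tensor and `h` is its algebraic Bianchi identity; as
in the Lichnerowicz computation, its Clifford contraction is then a scalar. -/
theorem contr_sum_scalar (ht : IsSkew t) (h : ∀ i j k l, sig t i j k l = 0) :
    ∃ c : ℝ, ∑ j, ∑ k, ∑ m, ∑ n, contr t j k m n • (clE j * clE k * clE m * clE n) =
      c • (1 : Cl6) := by
  set A := ∑ j, ∑ k, ∑ m, ∑ n, contr t j k m n • (clE j * clE k * clE m * clE n) with hA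
  set q : Fin 6 → Fin 6 → ℝ := fun a b => ∑ k, contr t a k k b with hq
  have hqs : ∀ a b, q a b = q b a := fun a b => Finset.sum_congr rfl fun k _ => by
    rw [← contr_comm, contr_swap_left ht, contr_swap_right ht, neg_neg]
  set X := ∑ a, ∑ b, q a b • (clE a * clE b) with hX
  have x1 : ∑ j, ∑ k, ∑ m, ∑ n, (if k = m then contr t j k m n • (clE j * clE n) else 0) = X := by
    refine Finset.sum_congr rfl fun j _ => ?_
    simp only [hq, Finset.sum_smul]
    rw [Finset.sum_comm (γ := Fin 6) (s := Finset.univ)]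
    conv_rhs => rw [Finset.sum_comm]
    rw [Finset.sum_comm]
    refine Finset.sum_congr rfl fun k _ => ?_
    rw [Finset.sum_comm]
    refine Finset.sum_congr rfl fun n _ => ?_
    simp
  have x2 : ∑ j, ∑ k, ∑ m, ∑ n, (if j = m then contr t j k m n • (clE k * clE n) else 0) = -X := by
    rw [← x1, Finset.sum_comm]
    simp only [← Finset.sum_neg_distrib]
    refine Finset.sum_congr rfl fun j _ => Finset.sum_congr rfl fun k _ =>
      Finset.sum_congr rfl fun m _ => Finset.sum_congr rfl fun n _ => ?_
    rw [contr_swap_left ht]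
    split_ifs <;> simp
  have x3 : ∀ j k m n,
      (if j = k then contr t j k m n • (clE m * clE n) else 0) = (0 : Cl6) := by
    intro j k m n
    split_ifs with hjk
    · subst hjk
      have : contr t j j m n = 0 := by linarith [contr_swap_left ht j j m n]
      rw [this, zero_smul]
    · rfl
  have e1 : ∀ j k m n, contr t j k m n • (clE m * clE j * clE k * clE n) =
      contr t j k m n • (clE j * clE k * clE m * clE n)
      + (2 : ℝ) • (if k = m then contr t j k m n • (clE j * clE n) else 0)
      - (2 : ℝ) • (if j = m then contr t j k m n • (clE k * clE n) else 0) := by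
    intro j k m n
    rw [clE_mul_three j k m, ← mul_assoc]
    simp only [add_mul, sub_mul, smul_mul_assoc]
    split_ifs <;> module
  have e2 : ∀ j k m n, contr t j k m n • (clE k * clE m * clE j * clE n) =
      contr t j k m n • (clE j * clE k * clE m * clE n)
      - (2 : ℝ) • (if j = m then contr t j k m n • (clE k * clE n) else 0)
      + (2 : ℝ) • (if j = k then contr t j k m n • (clE m * clE n) else 0) := by
    intro j k m n
    rw [clE_mul_three k m j, ← mul_assoc]
    simp only [add_mul, sub_mul, smul_mul_assoc, eq_comm (a := j)]
    split_ifs <;> module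
  have hB : ∑ j, ∑ k, ∑ m, ∑ n, contr t k m j n • (clE j * clE k * clE m * clE n) =
      A + (4 : ℝ) • X := by
    rw [Finset.sum_comm, Finset.sum_congr rfl fun k _ => Finset.sum_comm]
    simp only [e1, Finset.sum_add_distrib, Finset.sum_sub_distrib, ← Finset.smul_sum, x1, x2, ← hA]
    module
  have hC : ∑ j, ∑ k, ∑ m, ∑ n, contr t m j k n • (clE j * clE k * clE m * clE n) =
      A + (2 : ℝ) • X := by
    rw [Finset.sum_congr rfl fun k _ => Finset.sum_comm, Finset.sum_comm]
    simp only [e2, Finset.sum_add_distrib, Finset.sum_sub_distrib, ← Finset.smul_sum, x2, x3, ← hA,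
      Finset.sum_const_zero]
    module
  -- The three terms of the cyclic sum, put in the same Clifford order, all give `A`, up to the
  -- corrections 4X and 2X from the Clifford relations. So A = -2X, and X is a scalar since `q` is
  -- symmetric.
  have h0 : A + (A + (4 : ℝ) • X) + (A + (2 : ℝ) • X) = 0 := by
    rw [← hB, ← hC, hA]
    simp only [← Finset.sum_add_distrib, ← add_smul, ← sig_eq_contr ht, h, zero_smul,
      Finset.sum_const_zero]
  have h1 : A = (-2 : ℝ) • X := by
    have : (3 : ℝ) • A = (3 : ℝ) • ((-2 : ℝ) • X) := by
      rw [← sub_eq_zero, ← h0]; module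
    exact smul_right_injective _ three_ne_zero this
  rw [h1, hX, sum_symm_smul hqs]
  exact ⟨2 * ∑ i, q i i, by module⟩

/-- The linear form `x ↦ x_i`. -/
def coordDual (i : Fin 6) : Module.Dual ℝ (Fin 6 → ℝ) := LinearMap.proj i

theorem contractLeft_clE (a i : Fin 6) :
    CliffordAlgebra.contractLeft (coordDual a) (clE i) =
      (1 : Matrix (Fin 6) (Fin 6) ℝ) a i • (1 : Cl6) := by
  rw [clE, CliffordAlgebra.contractLeft_ι, Algebra.algebraMap_eq_smul_one]
  simp [coordDual, Pi.single_apply, Matrix.one_apply]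

theorem contractLeft_clE_mul (a i : Fin 6) (x : Cl6) :
    CliffordAlgebra.contractLeft (coordDual a) (clE i * x) =
      (1 : Matrix (Fin 6) (Fin 6) ℝ) a i • x
        - clE i * CliffordAlgebra.contractLeft (coordDual a) x := by
  rw [clE, CliffordAlgebra.contractLeft_ι_mul]
  simp [coordDual, Pi.single_apply, Matrix.one_apply]

/-- Contraction with four basis covectors. -/
def contractFour (a b c d : Fin 6) : Cl6 →ₗ[ℝ] Cl6 :=
  CliffordAlgebra.contractLeft (coordDual d) ∘ₗ CliffordAlgebra.contractLeft (coordDual c) ∘ₗ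
    CliffordAlgebra.contractLeft (coordDual b) ∘ₗ CliffordAlgebra.contractLeft (coordDual a)

theorem contractFour_apply (a b c d j k m n : Fin 6) {δ : Fin 6 → Fin 6 → ℝ}
    (hδ : (1 : Matrix (Fin 6) (Fin 6) ℝ) = δ) :
    contractFour a b c d (clE j * clE k * clE m * clE n) =
      (δ a j * δ b k * δ c m * δ d n - δ a j * δ b k * δ d m * δ c n
         - δ a j * δ c k * δ b m * δ d n + δ a j * δ c k * δ d m * δ b n
         + δ a j * δ d k * δ b m * δ c n - δ a j * δ d k * δ c m * δ b n
         - δ b j * δ a k * δ c m * δ d n + δ b j * δ a k * δ d m * δ c n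
         + δ b j * δ c k * δ a m * δ d n - δ b j * δ c k * δ d m * δ a n
         - δ b j * δ d k * δ a m * δ c n + δ b j * δ d k * δ c m * δ a n
         + δ c j * δ a k * δ b m * δ d n - δ c j * δ a k * δ d m * δ b n
         - δ c j * δ b k * δ a m * δ d n + δ c j * δ b k * δ d m * δ a n
         + δ c j * δ d k * δ a m * δ b n - δ c j * δ d k * δ b m * δ a n
         - δ d j * δ a k * δ b m * δ c n + δ d j * δ a k * δ c m * δ b n
         + δ d j * δ b k * δ a m * δ c n - δ d j * δ b k * δ c m * δ a n
         - δ d j * δ c k * δ a m * δ b n + δ d j * δ c k * δ b m * δ a n) • (1 : Cl6) := by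
  simp only [contractFour, LinearMap.comp_apply, mul_assoc, contractLeft_clE_mul, contractLeft_clE,
    map_sub, map_smul, mul_sub, mul_smul_comm, smul_sub, smul_smul, mul_one, hδ]
  module

theorem sum_mul_one_four (P : Fin 6 → Fin 6 → Fin 6 → Fin 6 → ℝ) (a b c d : Fin 6)
    {δ : Fin 6 → Fin 6 → ℝ} (hδ : (1 : Matrix (Fin 6) (Fin 6) ℝ) = δ) :
    ∑ j, ∑ k, ∑ m, ∑ n, P j k m n * (δ a j * δ b k * δ c m * δ d n) = P a b c d := by
  simp [← hδ, Matrix.one_apply]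

/-- By the symmetries of `contr`, the 24 signed permutations give each of the three terms of σ eight
times. -/
theorem contractFour_contr (ht : IsSkew t) (a b c d : Fin 6) :
    contractFour a b c d
      (∑ j, ∑ k, ∑ m, ∑ n, contr t j k m n • (clE j * clE k * clE m * clE n)) =
      (8 * sig t a b c d) • (1 : Cl6) := by
  simp only [map_sum, map_smul, contractFour_apply a b c d _ _ _ _ rfl, smul_smul, ← Finset.sum_smul,
    mul_add, mul_sub, Finset.sum_add_distrib, Finset.sum_sub_distrib, sum_mul_one_four _ _ _ _ _ rfl]
  congr 1
  rw [sig_eq_contr ht]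
  have h : ∀ a b c d, contr t b a c d = -contr t a b c d ∧ contr t a b d c = -contr t a b c d ∧
      contr t b a d c = contr t a b c d ∧ contr t c d a b = contr t a b c d ∧
      contr t d c a b = -contr t a b c d ∧ contr t c d b a = -contr t a b c d ∧
      contr t d c b a = contr t a b c d := by
    intro a b c d
    have h1 := contr_swap_left ht
    have h2 := contr_swap_right ht
    have h3 : contr t c d a b = contr t a b c d := contr_comm _ _ _ _
    refine ⟨h1 .., h2 .., ?_, h3, ?_, ?_, ?_⟩
    · rw [h1, h2, neg_neg]
    · rw [h1, h3]
    · rw [h2, h3]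
    · rw [h1, h2, h3, neg_neg]
  obtain ⟨p1, p2, p3, p4, p5, p6, p7⟩ := h a b c d
  obtain ⟨q1, q2, q3, q4, q5, q6, q7⟩ := h a c b d
  obtain ⟨r1, r2, r3, r4, r5, r6, r7⟩ := h a d b c
  rw [p1, p2, p3, p4, p5, p6, p7, q1, q2, q3, q4, q5, q6, q7, r1, r2, r3, r4, r5, r6, r7]
  ring

theorem cubic_eq_toCl {T : Ten3} (hT : T ∈ Lam3) :
    cubic (fun i j k => T (i, j, k)) = (6 : ℝ) • toCl T := by
  have h0 : ∀ i k, T (i, i, k) = 0 := fun i k => by linarith [(hT i i k).1]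
  have h0' : ∀ i k, T (i, k, k) = 0 := fun i k => by linarith [(hT i k k).2]
  rw [cubic, sum_eq_six_nsmul, toCl, ← Nat.cast_smul_eq_nsmul ℝ]
  · norm_num
  · intro i j k
    rcases eq_or_ne i j with rfl | hij
    · rfl
    · rw [(hT i j k).1, clE_mul_clE i j, if_neg hij]
      simp
  · intro i j k
    rcases eq_or_ne j k with rfl | hij
    · rfl
    · rw [(hT i j k).2, mul_assoc, clE_mul_clE j k, if_neg hij, mul_assoc]
      simp
  · intro i k
    rw [h0, zero_smul]

/-- By `cubic_sq`, only the sum of the squares of `quadratic` matters. Contraction with four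
covectors kills scalars and returns 8σ from this sum. The factor 36 is the square of the 6 in
`cubic_eq_toCl`. -/
theorem toCl_sq_iff {T : Ten3} (hT : T ∈ Lam3) :
    (∃ c : ℝ, toCl T ^ 2 = algebraMap ℝ Cl6 c) ↔
      ∀ i j k l, sig (fun i j k => T (i, j, k)) i j k l = 0 := by
  have ht : IsSkew fun i j k => T (i, j, k) := hT
  have h := cubic_sq ht
  rw [cubic_eq_toCl hT, sum_quadratic_sq, smul_pow] at h
  simp only [Algebra.algebraMap_eq_smul_one]
  constructor
  · rintro ⟨c, hc⟩ i j k l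
    rw [hc] at h
    have h2 := congrArg (contractFour i j k l) h
    have h1 : contractFour i j k l 1 = 0 := by
      simp [contractFour, CliffordAlgebra.contractLeft_one]
    simp only [map_sub, map_neg, map_smul, h1, contractFour_contr ht, smul_zero, sub_zero] at h2
    rw [eq_comm, neg_eq_zero, smul_smul, smul_eq_zero] at h2
    have := h2.resolve_right one_ne_zero
    linarith
  · intro h0
    obtain ⟨c, hc⟩ := contr_sum_scalar ht h0
    rw [hc] at h
    refine ⟨(-(9 * c) - 12 * ∑ i, ∑ j, ∑ k, T (i, j, k) ^ 2) / 36, ?_⟩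
    have : (36 : ℝ) • toCl T ^ 2 = (36 : ℝ) •
        (((-(9 * c) - 12 * ∑ i, ∑ j, ∑ k, T (i, j, k) ^ 2) / 36) • (1 : Cl6)) := by
      rw [show (36 : ℝ) = 6 ^ 2 by norm_num, h]
      module
    exact smul_right_injective _ (by norm_num : (36 : ℝ) ≠ 0) this

end Clifford

/-! ### The intrinsic torsion as θ(T), and the main equivalence. -/

section Manifold
variable {M : Type*} [TopologicalSpace M] [ChartedSpace R6 M] [IsManifold (𝓡 6) ∞ M]
  [RiemannianBundle (TangentSpace (𝓡 6) : M → Type)]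
  [IsContMDiffRiemannianBundle (𝓡 6) ∞ R6 (TangentSpace (𝓡 6) : M → Type)]
  {cov : CovariantDerivative (𝓡 6) R6 (TangentSpace (𝓡 6) : M → Type)}
  {J : (p : M) → TangentSpace (𝓡 6) p →L[ℝ] TangentSpace (𝓡 6) p}
  {p : M} {e : Fin 6 → TangentSpace (𝓡 6) p}

theorem IsCharacteristicConnection.components_mem (hc : IsCharacteristicConnection J cov) :
    components (torsionForm cov p) e ∈ Lam3 :=
  (hc.isSkewTorsion p).isSkew e

/-- In an adapted frame J acts through Ω, so -1/4 (T - T(·, J·, J·)) is -1/2 times the projection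
`prM`. -/
theorem IsCharacteristicConnection.components_intrinsicTorsion (hJ : IsOrthogonalAlmostComplex J)
    (hc : IsCharacteristicConnection J cov) (he : IsAdaptedFrame J p e) :
    components (intrinsicTorsion J p) e = theta (components (torsionForm cov p) e) := by
  have hJe : ∀ i, J p (e i) = ∑ a, Om i a • e a :=
    (isAdaptedFrame_iff.1 he).apply_J (finrank_tangentSpace p)
  have h : ∀ k i j, torsionForm cov p (e k) (J p (e i)) (J p (e j)) =
      ∑ a, ∑ b, Om i a * Om j b * torsionForm cov p (e k) (e a) (e b) := by
    intro k i j
    simp only [hJe, torsionForm, map_sum, map_smul, sum_inner, inner_sum, inner_smul_left,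
      inner_smul_right, RCLike.conj_to_real]
    rw [Finset.sum_comm]
    refine Finset.sum_congr rfl fun b _ => ?_
    rw [Finset.mul_sum]
    exact Finset.sum_congr rfl fun a _ => by ring
  ext ⟨k, i, j⟩
  simp only [components, ten_apply, hc.intrinsicTorsion_eq hJ, theta, prM, LinearMap.smul_apply,
    LinearMap.coe_mk, AddHom.coe_mk, PiLp.smul_apply, smul_eq_mul, h]
  ring

theorem IsCharacteristicConnection.formNormSq_combination (hJ : IsOrthogonalAlmostComplex J)
    (hc : IsCharacteristicConnection J cov) (he : IsAdaptedFrame J p e) :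
    3 * formNormSq (T2 J p e) - formNormSq (T12 J p e) + formNormSq (T6 J p e) =
      2 * sigTrace (torsionComp (torsionMap cov p) e) := by
  rw [T2, T12, T6, hc.components_intrinsicTorsion hJ he]
  exact formComponent_combination hc.components_mem

end Manifold

end AlmostHermitian
end

theorem mainTheorem11
    {M : Type*} [TopologicalSpace M] [T2Space M] [SecondCountableTopology M]
    [ChartedSpace (EuclideanSpace ℝ (Fin 6)) M] [IsManifold (𝓡 6) ∞ M]
    [RiemannianBundle (TangentSpace (𝓡 6) : M → Type)]
    [IsContMDiffRiemannianBundle (𝓡 6) ∞ AlmostHermitian.R6 (TangentSpace (𝓡 6) : M → Type)]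
    (J : (p : M) → TangentSpace (𝓡 6) p →L[ℝ] TangentSpace (𝓡 6) p)
    (hJ : AlmostHermitian.IsOrthogonalAlmostComplex J)
    (cov : CovariantDerivative (𝓡 6) AlmostHermitian.R6 (TangentSpace (𝓡 6) : M → Type))
    (hcov : AlmostHermitian.IsCharacteristicConnection J cov)
    (hpar : AlmostHermitian.HasParallelTorsion cov) :
    List.TFAE [
      ∀ (p : M) (e : Fin 6 → TangentSpace (𝓡 6) p), AlmostHermitian.IsAdaptedFrame J p e →
        ∃ c : ℝ, AlmostHermitian.toCl
          (AlmostHermitian.components (AlmostHermitian.torsionForm cov p) e) ^ 2 =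
            algebraMap ℝ AlmostHermitian.Cl6 c,
      ∀ (p : M) (e : Fin 6 → TangentSpace (𝓡 6) p), AlmostHermitian.IsAdaptedFrame J p e →
        3 * AlmostHermitian.formNormSq (AlmostHermitian.T2 J p e)
          - AlmostHermitian.formNormSq (AlmostHermitian.T12 J p e)
          + AlmostHermitian.formNormSq (AlmostHermitian.T6 J p e) = 0,
      AlmostHermitian.IsClosedThree (AlmostHermitian.torsionForm cov)] := by
  rw [hcov.isClosedThree_iff hpar]
  tfae_have 3 → 1 := fun h p e he =>
    (AlmostHermitian.toCl_sq_iff hcov.components_mem).2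
      ((he.sigmaForm_eq_zero_iff hcov).1 (h p))
  -- One adapted frame at each point suffices, because σ is a tensor.
  tfae_have 1 → 3 := fun h p => by
    obtain ⟨e, he⟩ := hJ.exists_isAdaptedFrame p
    exact (he.sigmaForm_eq_zero_iff hcov).2
      ((AlmostHermitian.toCl_sq_iff hcov.components_mem).1 (h p e he))
  tfae_have 3 → 2 := fun h p e he => by
    have hs := (he.sigmaForm_eq_zero_iff hcov).1 (h p)
    rw [hcov.formNormSq_combination hJ he, AlmostHermitian.sigTrace, hs, hs, hs]
    norm_num
  tfae_have 2 → 3 := fun h p => hcov.sigmaForm_eq_zero hJ hpar p fun e he => by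
    have h2 := h p e he
    rw [hcov.formNormSq_combination hJ he] at h2
    linarith
  tfae_finish
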